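/- Let $N>2$ and $p>1$ be real numbers (for instance $N$ an integer $\ge 3$). For $k<0$ consider on $[0,\pi/2)$ the initial value problem $$\big((p-1)(y')^2+k^2y^2\big)y''=\big((3-2p)k+p-N\big)k\,y\,(y')^2+\big(k(1-p)+p-N\big)k^3y^3+(2-N)\,y'\cot(x)\,\big((y')^2+k^2y^2\big),\qquad y(0)=1,\ y'(0)=0, \tag{1}$$ where a solution is a $C^2$ function on $[0,\pi/2)$ that satisfies the equation on $(0,\pi/2)$, and the Riccati problem $$\big((p-1)H^2+k^2\big)\big(H'+H^2\big)=\big((3-2p)k+p-N\big)kH^2+\big(k(1-p)+p-N\big)k^3+(2-N)H\cot(x)\,\big(H^2+k^2\big),\qquad H(0)=0, \tag{2}$$ where a solution is a $C^1$ function on $[0,\pi/2)$ that satisfies the equation on $(0,\pi/2)$. Consider the properties $$0<y(x)<1,\quad y'(x)<0\quad\text{for all }x\in(0,\pi/2),\qquad \lim_{x\to(\pi/2)^-}y(x)=0, \tag{P}$$ $$-\infty<H(x)<0,\quad H'(x)<0\quad\text{for all }x\in(0,\pi/2),\qquad \lim_{x\to(\pi/2)^-}H(x)=-\infty. \tag{R}$$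 Put $I=\left(-\infty,\frac{N-p}{1-p}\right)$ if $1<p<N$, and $I=(-\infty,0)$ if $p\ge N$. Then there is $k(p,N)\in I$ such that: * for $k=k(p,N)$, problem (1) has exactly one solution $y$ on $[0,\pi/2)$, and it satisfies (P); problem (2) has exactly one solution $H$ on $[0,\pi/2)$, and it satisfies (R); moreover $H=y'/y$ on $(0,\pi/2)$; * for every other $k\in I$, no solution of (1) on $[0,\pi/2)$ satisfies (P), and no solution of (2) on $[0,\pi/2)$ satisfies (R). -/

import Mathlib

open Set Filter Topology

namespace Quasiradial

/-- `y` is a classical (`C²` up to and including the left endpoint) solution on `[0, π/2)` of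
`((p-1)y'² + k²y²) y'' = ((3-2p)k + p - N) k y y'² + (k(1-p) + p - N) k³ y³`
`  + (2-N) y' cot x (y'² + k²y²)` with `y(0) = 1`, `y'(0) = 0`.
(The equation is imposed on `(0, π/2)`, because `cot` is singular at `0`.) -/
structure IsSolution (p N k : ℝ) (y : ℝ → ℝ) : Prop where
  contDiffOn : ContDiffOn ℝ 2 y (Ico 0 (Real.pi / 2))
  init : y 0 = 1
  init_deriv : derivWithin y (Ico 0 (Real.pi / 2)) 0 = 0
  eqn : ∀ x ∈ Ioo 0 (Real.pi / 2),
    ((p - 1) * (deriv y x) ^ 2 + k ^ 2 * (y x) ^ 2) * deriv (deriv y) x =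
      ((3 - 2 * p) * k + p - N) * k * y x * (deriv y x) ^ 2
        + (k * (1 - p) + p - N) * k ^ 3 * (y x) ^ 3
        + (2 - N) * deriv y x * Real.cot x * ((deriv y x) ^ 2 + k ^ 2 * (y x) ^ 2)

/-- `0 < y < 1` and `y' < 0` on `(0, π/2)`, and `y → 0` at `π/2` from the left. -/
structure IsProfile (y : ℝ → ℝ) : Prop where
  pos : ∀ x ∈ Ioo 0 (Real.pi / 2), 0 < y x
  lt_one : ∀ x ∈ Ioo 0 (Real.pi / 2), y x < 1
  deriv_neg : ∀ x ∈ Ioo 0 (Real.pi / 2), deriv y x < 0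
  tendsto_zero : Tendsto y (𝓝[<] (Real.pi / 2)) (𝓝 0)

/-- `H` is a classical (`C¹` up to and including the left endpoint) solution on `[0, π/2)` of
`((p-1)H² + k²)(H' + H²) = ((3-2p)k + p - N) k H² + (k(1-p) + p - N) k³`
`  + (2-N) H cot x (H² + k²)` with `H(0) = 0`. -/
structure IsRiccatiSolution (p N k : ℝ) (H : ℝ → ℝ) : Prop where
  contDiffOn : ContDiffOn ℝ 1 H (Ico 0 (Real.pi / 2))
  init : H 0 = 0
  eqn : ∀ x ∈ Ioo 0 (Real.pi / 2),
    ((p - 1) * (H x) ^ 2 + k ^ 2) * (deriv H x + (H x) ^ 2) =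
      ((3 - 2 * p) * k + p - N) * k * (H x) ^ 2
        + (k * (1 - p) + p - N) * k ^ 3
        + (2 - N) * H x * Real.cot x * ((H x) ^ 2 + k ^ 2)

/-- `H < 0` and `H' < 0` on `(0, π/2)`, and `H → -∞` at `π/2` from the left. -/
structure IsRiccatiProfile (H : ℝ → ℝ) : Prop where
  neg : ∀ x ∈ Ioo 0 (Real.pi / 2), H x < 0
  deriv_neg : ∀ x ∈ Ioo 0 (Real.pi / 2), deriv H x < 0
  tendsto_atBot : Tendsto H (𝓝[<] (Real.pi / 2)) atBot

/-- For the parameter `k` the initial value problem for `y` has exactly one solution on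
`[0, π/2)`, and this solution is a profile. -/
def SolutionIsProfile (p N k : ℝ) : Prop :=
  ∃ y, IsSolution p N k y ∧ IsProfile y ∧
    ∀ z, IsSolution p N k z → EqOn z y (Ico 0 (Real.pi / 2))

/-- For the parameter `k` the initial value problem for `H` has exactly one solution on
`[0, π/2)`, and this solution is a Riccati profile. -/
def RiccatiSolutionIsProfile (p N k : ℝ) : Prop :=
  ∃ H, IsRiccatiSolution p N k H ∧ IsRiccatiProfile H ∧
    ∀ G, IsRiccatiSolution p N k G → EqOn G H (Ico 0 (Real.pi / 2))

/-- `I` contains a parameter `k` for which the solutions `y` and `H` are profiles and satisfy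
`H = y'/y`, and no other parameter in `I` admits a solution `y` that is a profile, or a solution
`H` that is a Riccati profile. -/
def HasUniqueExponent (p N : ℝ) (I : Set ℝ) : Prop :=
  ∃ k ∈ I,
    SolutionIsProfile p N k ∧
    RiccatiSolutionIsProfile p N k ∧
    (∀ y H, IsSolution p N k y → IsRiccatiSolution p N k H →
      ∀ x ∈ Ioo 0 (Real.pi / 2), H x = deriv y x / y x) ∧
    (∀ k' ∈ I, (∃ y, IsSolution p N k' y ∧ IsProfile y) → k' = k) ∧
    (∀ k' ∈ I, (∃ H, IsRiccatiSolution p N k' H ∧ IsRiccatiProfile H) → k' = k)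

end Quasiradial

/-! Put `H = k tan φ` and `κ = -k`. The Riccati equation becomes `φ' = angleField p N κ x φ`, whose
right-hand side is smooth and periodic in `φ`. Blow-up of `H` turns into the regular condition `φ =
π/2` at `x = π/2`, an interior point of `(0, π)`, and the only singularity left is that of `cot x`
at `0`. The claim is now that exactly one `κ` admits a solution joining `φ = 0` at `0` to `φ = π/2`
at `π/2`.

Existence is by shooting backwards. For every `κ` the terminal value problem has a solution on `(0,
π)` that depends continuously on `κ`. Near `0` a solution cannot lie both above the line `C x` and
below `-C x` at different points, because the field on these lines is bounded by less than `C` in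
the relevant direction. Either escape is an open condition on `κ`, a small `κ` escapes upwards and a
large one downwards, so by connectedness some `κ` does neither (`exists_angle_solution`). Then `φ =
O(x)`, L'Hôpital gives the slope at `0`, and `φ` is `C¹` and increasing.

Uniqueness rests on the sign of the singular term: near `φ = 0` it is dissipative, so the field is
one-sided Lipschitz along curves issuing from `0`. This yields `angle_unique`, and also
`angle_comparison`: a strict supersolution lies above, and the gap cannot close at `π/2`. As the
field increases strictly with `κ`, two parameters cannot both connect `0` to `π/2`
(`param_le_of_angle`).

The function `y` is recovered as `exp ∫ H`. Conversely, the angle of any profile tends to `π/2`,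
which transfers uniqueness of `k` back to both problems. -/

namespace Quasiradial

/-! ### The equation for the angle `φ` with `H = k tan φ` -/

/-- The coefficient `cos² θ + (p - 1) sin² θ` of the angle equation. -/
noncomputable def angleDen (p θ : ℝ) : ℝ := Real.cos θ ^ 2 + (p - 1) * Real.sin θ ^ 2

/-- The right-hand side of the equation satisfied by `φ = arctan (H / k)`, where `κ = -k`. -/
noncomputable def angleField (p N κ x θ : ℝ) : ℝ :=
  (κ * (p - 1) + (p - N) * Real.cos θ ^ 2
    - (N - 2) * (Real.sin θ * Real.cos θ) * Real.cot x) / angleDen p θ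

variable {p N κ k : ℝ}

lemma min_le_angleDen (θ : ℝ) : min 1 (p - 1) ≤ angleDen p θ := by
  unfold angleDen
  have h := Real.sin_sq_add_cos_sq θ
  have h1 : min 1 (p - 1) ≤ 1 := min_le_left _ _
  have h2 : min 1 (p - 1) ≤ p - 1 := min_le_right _ _
  nlinarith [mul_nonneg (sub_nonneg.2 h1) (sq_nonneg (Real.cos θ)),
    mul_nonneg (sub_nonneg.2 h2) (sq_nonneg (Real.sin θ))]

lemma min_one_sub_pos (hp : 1 < p) : 0 < min 1 (p - 1) := lt_min one_pos (by linarith)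

lemma angleDen_pos (hp : 1 < p) (θ : ℝ) : 0 < angleDen p θ :=
  (min_one_sub_pos hp).trans_le (min_le_angleDen θ)

lemma angleDen_le (hp : 1 < p) (θ : ℝ) : angleDen p θ ≤ p := by
  unfold angleDen
  nlinarith [Real.sin_sq_add_cos_sq θ, sq_nonneg (Real.sin θ), sq_nonneg (Real.cos θ)]

/-- Over the common denominator the difference is divisible by `sin (b - a)`, which isolates the
`cot` term: its coefficient is positive for `a`, `b` near `0`. Both the two-sided and the one-sided
Lipschitz bounds are read off from this identity. -/
lemma angleField_sub (hp : 1 < p) (x a b : ℝ) :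
    angleField p N κ x b - angleField p N κ x a =
      -(Real.sin (b - a) * ((p - 1) * (κ * (p - 2) + p - N) * Real.sin (a + b)
        + (N - 2) * Real.cot x *
          (Real.cos a * Real.cos b - (p - 1) * (Real.sin a * Real.sin b)))) /
        (angleDen p a * angleDen p b) := by
  unfold angleField
  rw [div_sub_div _ _ (angleDen_pos hp b).ne' (angleDen_pos hp a).ne', mul_comm (angleDen p a)]
  congr 1
  unfold angleDen
  rw [Real.sin_sub, Real.sin_add]
  have ha : Real.sin a ^ 2 = 1 - Real.cos a ^ 2 := Real.sin_sq a
  have hb : Real.sin b ^ 2 = 1 - Real.cos b ^ 2 := Real.sin_sq b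
  ring_nf
  simp only [ha, hb]
  ring

lemma angleField_lipschitz (hp : 1 < p) :
    ∃ K, 0 ≤ K ∧ ∀ x a b, |angleField p N κ x b - angleField p N κ x a| ≤
      K * (1 + |Real.cot x|) * |b - a| := by
  set m := min 1 (p - 1)
  have hm : 0 < m := min_one_sub_pos hp
  set A := |(p - 1) * (κ * (p - 2) + p - N)|
  set B := |N - 2| * p
  have hB : 0 ≤ B := mul_nonneg (abs_nonneg _) (by linarith)
  have hA : 0 ≤ A := abs_nonneg _
  refine ⟨(A + B) / (m * m), by positivity, fun x a b => ?_⟩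
  rw [angleField_sub hp, abs_div, abs_neg, abs_mul,
    abs_of_pos (mul_pos (angleDen_pos hp a) (angleDen_pos hp b)),
    div_le_iff₀ (mul_pos (angleDen_pos hp a) (angleDen_pos hp b))]
  have hden : m * m ≤ angleDen p a * angleDen p b :=
    mul_le_mul (min_le_angleDen a) (min_le_angleDen b) hm.le (angleDen_pos hp a).le
  have h1 : |Real.sin (b - a)| ≤ |b - a| := Real.abs_sin_le_abs
  have hcc : |Real.cos a * Real.cos b - (p - 1) * (Real.sin a * Real.sin b)| ≤ p := by
    have e1 : |Real.cos a * Real.cos b| ≤ 1 := by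
      rw [abs_mul]; exact mul_le_one₀ (Real.abs_cos_le_one a) (abs_nonneg _) (Real.abs_cos_le_one b)
    have e2 : |Real.sin a * Real.sin b| ≤ 1 := by
      rw [abs_mul]; exact mul_le_one₀ (Real.abs_sin_le_one a) (abs_nonneg _) (Real.abs_sin_le_one b)
    calc _ ≤ |Real.cos a * Real.cos b| + |(p - 1) * (Real.sin a * Real.sin b)| := abs_sub _ _
      _ ≤ 1 + (p - 1) * 1 := by
          rw [abs_mul (p - 1), abs_of_pos (by linarith : 0 < p - 1)]
          gcongr
      _ = p := by ring
  have h2 : |(p - 1) * (κ * (p - 2) + p - N) * Real.sin (a + b)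
        + (N - 2) * Real.cot x *
          (Real.cos a * Real.cos b - (p - 1) * (Real.sin a * Real.sin b))|
        ≤ (A + B) * (1 + |Real.cot x|) := by
    calc _ ≤ |(p - 1) * (κ * (p - 2) + p - N) * Real.sin (a + b)| + |(N - 2) * Real.cot x *
          (Real.cos a * Real.cos b - (p - 1) * (Real.sin a * Real.sin b))| := abs_add_le _ _
      _ ≤ A * 1 + |N - 2| * |Real.cot x| * p := by
          rw [abs_mul, abs_mul _ (Real.cos a * Real.cos b - _), abs_mul (N - 2)]
          gcongr
          exact Real.abs_sin_le_one _
      _ ≤ _ := by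
          have := abs_nonneg (Real.cot x)
          nlinarith [mul_nonneg hA this]
  have hC : 0 ≤ (A + B) * (1 + |Real.cot x|) := by positivity
  calc _ ≤ |b - a| * ((A + B) * (1 + |Real.cot x|)) := by gcongr
    _ = (A + B) / (m * m) * (1 + |Real.cot x|) * |b - a| * (m * m) := by field_simp
    _ ≤ _ := by gcongr

lemma cot_nonneg_of_mem {x : ℝ} (hx : x ∈ Ioo 0 (Real.pi / 2)) : 0 ≤ Real.cot x := by
  rw [Real.cot_eq_cos_div_sin]
  exact div_nonneg (Real.cos_nonneg_of_mem_Icc ⟨by linarith [hx.1, Real.pi_pos], hx.2.le⟩)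
    (Real.sin_nonneg_of_nonneg_of_le_pi hx.1.le (by linarith [hx.2, Real.pi_pos]))

lemma cot_le_inv {x : ℝ} (hx : x ∈ Ioo 0 (Real.pi / 2)) : Real.cot x ≤ x⁻¹ := by
  rw [← Real.tan_inv_eq_cot]
  exact inv_anti₀ hx.1 (Real.lt_tan hx.1 hx.2).le

/-- Near `θ = 0` the singular term of the angle equation is dissipative. -/
lemma angleField_oneSided (hp : 1 < p) (hN : 2 < N) :
    ∃ K r, 0 ≤ K ∧ 0 < r ∧ ∀ x ∈ Ioo 0 (Real.pi / 2), ∀ a b, |a| ≤ r → |b| ≤ r → a ≤ b →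
      angleField p N κ x b - angleField p N κ x a ≤ K * (b - a) := by
  have hcont : Continuous fun z : ℝ × ℝ =>
      Real.cos z.1 * Real.cos z.2 - (p - 1) * (Real.sin z.1 * Real.sin z.2) := by fun_prop
  have hev : ∀ᶠ z : ℝ × ℝ in 𝓝 (0, 0),
      0 < Real.cos z.1 * Real.cos z.2 - (p - 1) * (Real.sin z.1 * Real.sin z.2) :=
    hcont.continuousAt.eventually_const_lt (by simp)
  obtain ⟨ε, hε, hball⟩ := Metric.eventually_nhds_iff.1 hev
  -- `r < ε` keeps `(a, b)` where the coefficient of `cot` is positive; `r < 1` gives `b - a < π`,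
  -- hence `0 ≤ sin (b - a)`.
  obtain ⟨r, hr, hr1, hr2⟩ : ∃ r : ℝ, 0 < r ∧ r < ε ∧ r < 1 :=
    ⟨min ε 1 / 2, by positivity, by linarith [min_le_left ε 1, lt_min hε one_pos],
      by linarith [min_le_right ε 1, lt_min hε one_pos]⟩
  set m := min 1 (p - 1)
  have hm : 0 < m := min_one_sub_pos hp
  set A := |(p - 1) * (κ * (p - 2) + p - N)|
  have hA : 0 ≤ A := abs_nonneg _
  refine ⟨A / (m * m), r, by positivity, hr, fun x hx a b ha hb hab => ?_⟩
  have hs0 : 0 ≤ Real.sin (b - a) := by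
    rw [abs_le] at ha hb
    exact Real.sin_nonneg_of_nonneg_of_le_pi (by linarith) (by linarith [Real.pi_gt_three])
  have hs1 : Real.sin (b - a) ≤ b - a := Real.sin_le (by linarith)
  have hpos := hball (y := (a, b)) (by
    rw [Prod.dist_eq]; simp only [Real.dist_eq, sub_zero]
    exact max_lt (by linarith) (by linarith))
  have hden : m * m ≤ angleDen p a * angleDen p b :=
    mul_le_mul (min_le_angleDen a) (min_le_angleDen b) hm.le (angleDen_pos hp a).le
  rw [angleField_sub hp, div_le_iff₀ (mul_pos (angleDen_pos hp a) (angleDen_pos hp b))]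
  have hsing : 0 ≤ (N - 2) * Real.cot x *
      (Real.cos a * Real.cos b - (p - 1) * (Real.sin a * Real.sin b)) :=
    mul_nonneg (mul_nonneg (by linarith) (cot_nonneg_of_mem hx)) hpos.le
  have hreg : -A ≤ (p - 1) * (κ * (p - 2) + p - N) * Real.sin (a + b) := by
    refine (abs_le.1 ?_).1
    rw [abs_mul]
    exact mul_le_of_le_one_right hA (Real.abs_sin_le_one _)
  calc _ ≤ Real.sin (b - a) * A := by
        rw [← mul_neg]; gcongr; linarith
    _ ≤ (b - a) * A := by gcongr
    _ = A / (m * m) * (b - a) * (m * m) := by field_simp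
    _ ≤ _ := by
        gcongr

/-- Along two curves issuing from `0` the angle field is one-sided Lipschitz. -/
lemma angleField_oneSided_curves (hp : 1 < p) (hN : 2 < N) {u v : ℝ → ℝ}
    (hu : Tendsto u (𝓝[>] 0) (𝓝 0)) (hv : Tendsto v (𝓝[>] 0) (𝓝 0)) :
    ∃ L, 0 ≤ L ∧ ∀ x ∈ Ioo 0 (Real.pi / 2),
      (u x ≤ v x → angleField p N κ x (v x) - angleField p N κ x (u x) ≤ L * (v x - u x)) ∧
      (v x ≤ u x → angleField p N κ x (u x) - angleField p N κ x (v x) ≤ L * (u x - v x)) := by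
  obtain ⟨K, r, hK, hr, hone⟩ := angleField_oneSided (κ := κ) hp hN
  obtain ⟨K', hK', hlip⟩ := angleField_lipschitz (N := N) (κ := κ) hp
  have hev : ∀ᶠ x in 𝓝[>] (0 : ℝ), |u x| ≤ r ∧ |v x| ≤ r := by
    filter_upwards [hu (Metric.closedBall_mem_nhds 0 hr), hv (Metric.closedBall_mem_nhds 0 hr)]
      with x h1 h2
    simpa [Real.dist_eq] using And.intro h1 h2
  obtain ⟨δ, hδ, hsub⟩ := mem_nhdsGT_iff_exists_Ioo_subset.1 hev
  have hδ : 0 < δ := hδ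
  -- For `x < δ` both curves are in the dissipative zone and `K` suffices; for `x ≥ δ` one has `cot
  -- x ≤ δ⁻¹` and the two-sided bound applies.
  refine ⟨K + K' * (1 + δ⁻¹), by positivity, fun x hx => ?_⟩
  by_cases hxδ : x < δ
  · obtain ⟨h1, h2⟩ := hsub ⟨hx.1, hxδ⟩
    have : 0 ≤ K' * (1 + δ⁻¹) := by positivity
    constructor <;> intro h
    · have := hone x hx _ _ h1 h2 h
      nlinarith
    · have := hone x hx _ _ h2 h1 h
      nlinarith
  · have hcot : |Real.cot x| ≤ δ⁻¹ := by
      rw [abs_of_nonneg (cot_nonneg_of_mem hx)]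
      exact (cot_le_inv hx).trans (inv_anti₀ hδ (not_lt.1 hxδ))
    have key : ∀ a b, a ≤ b → angleField p N κ x b - angleField p N κ x a ≤
        (K + K' * (1 + δ⁻¹)) * (b - a) := fun a b hab => by
      calc _ ≤ K' * (1 + |Real.cot x|) * |b - a| := (le_abs_self _).trans (hlip x a b)
        _ ≤ K' * (1 + δ⁻¹) * (b - a) := by
          rw [abs_of_nonneg (sub_nonneg.2 hab)]
          have := sub_nonneg.2 hab
          gcongr
        _ ≤ _ := by nlinarith [mul_nonneg hK (sub_nonneg.2 hab)]
    exact ⟨key _ _, key _ _⟩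

/-! ### Differential inequalities -/

/-- Such a function crosses zero only upwards. A barrier argument gives `0 ≤ v`; a zero at `y`
would, with positive derivative, make `v` negative just to its left. All the barrier arguments below
use this. -/
lemma pos_of_deriv_pos_at_zeros {v v' : ℝ → ℝ} {a b x y : ℝ}
    (hv : ∀ x ∈ Ioo a b, HasDerivAt v (v' x) x) (h : ∀ x ∈ Ioo a b, v x = 0 → 0 < v' x)
    (hx : x ∈ Ioo a b) (hy : y ∈ Ioo a b) (hxy : x < y) (h0 : 0 ≤ v x) : 0 < v y := by
  have hsub : Icc x y ⊆ Ioo a b := Icc_subset_Ioo hx.1 hy.2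
  have hnn : ∀ ⦃z⦄, z ∈ Icc x y → -v z ≤ 0 :=
    image_le_of_deriv_right_lt_deriv_boundary (f := fun z => -v z) (f' := fun z => -v' z)
      (B := fun _ => 0) (B' := fun _ => 0)
      (fun z hz => (hv z (hsub hz)).neg.continuousAt.continuousWithinAt)
      (fun z hz => (hv z (hsub (Ico_subset_Icc_self hz))).neg.hasDerivWithinAt)
      (by simpa using h0) (fun z => hasDerivAt_const z 0)
      (fun z hz hz0 => by
        have := h z (hsub (Ico_subset_Icc_self hz)) (by simpa using hz0)
        simpa using this)
  rcases (neg_nonpos.1 (hnn (right_mem_Icc.2 hxy.le))).lt_or_eq with h1 | h1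
  · exact h1
  · exfalso
    have hd := hv y hy
    have hpos := h y hy h1.symm
    have hev : ∀ᶠ z in 𝓝[<] y, 0 < slope v y z :=
      (hasDerivAt_iff_tendsto_slope.1 hd |>.mono_left
        (nhdsWithin_mono _ fun z hz => ne_of_lt hz)).eventually_const_lt hpos
    obtain ⟨z, hz1, hz2⟩ := (hev.and (Ioo_mem_nhdsLT hxy)).exists
    rw [slope_def_field, ← h1, sub_zero] at hz1
    have := hnn ⟨hz2.1.le, hz2.2.le⟩
    have := div_nonpos_of_nonneg_of_nonpos (neg_nonpos.1 this) (sub_nonpos.2 hz2.2.le)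
    linarith

/-- A nonpositive value at `x₁` would force `w < 0` on all of `(0, x₁)`, since zeros are crossed
upwards. There `exp (-L x) w` is nondecreasing and starts from the limit `0`, so it is nonnegative:
a contradiction. -/
lemma pos_of_linear_growth {w w' : ℝ → ℝ} {b c L : ℝ} (hc : 0 < c)
    (hw : ∀ x ∈ Ioo 0 b, HasDerivAt w (w' x) x)
    (hgrow : ∀ x ∈ Ioo 0 b, w x ≤ 0 → c + L * w x ≤ w' x)
    (h0 : Tendsto w (𝓝[>] 0) (𝓝 0)) : ∀ x ∈ Ioo 0 b, 0 < w x := by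
  by_contra! hcon
  obtain ⟨x₁, hx₁, hneg⟩ := hcon
  have hle : ∀ x ∈ Ioo 0 x₁, w x < 0 := by
    intro x hx
    by_contra! hge
    refine hneg.not_gt (pos_of_deriv_pos_at_zeros hw (fun z hz hz0 => ?_)
      ⟨hx.1, hx.2.trans hx₁.2⟩ hx₁ hx.2 hge)
    have := hgrow z hz hz0.le
    rw [hz0] at this
    linarith
  have hd : ∀ x ∈ Ioo 0 b, HasDerivAt (fun x => Real.exp (-L * x) * w x)
      (Real.exp (-L * x) * (w' x - L * w x)) x := fun x hx => by
    have h1 : HasDerivAt (fun x => Real.exp (-L * x)) (Real.exp (-L * x) * (-L)) x := by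
      simpa using ((hasDerivAt_id x).const_mul (-L)).exp
    exact (h1.mul (hw x hx)).congr_deriv (by ring)
  have hmono : MonotoneOn (fun x => Real.exp (-L * x) * w x) (Ioo 0 x₁) := by
    have hsub : Ioo 0 x₁ ⊆ Ioo 0 b := Ioo_subset_Ioo_right hx₁.2.le
    refine monotoneOn_of_deriv_nonneg (convex_Ioo _ _)
      (fun x hx => (hd x (hsub hx)).continuousAt.continuousWithinAt) ?_ ?_
    · rw [interior_Ioo]
      exact fun x hx => (hd x (hsub hx)).differentiableAt.differentiableWithinAt
    · rw [interior_Ioo]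
      intro x hx
      rw [(hd x (hsub hx)).deriv]
      have := hgrow x (hsub hx) (hle x hx).le
      exact mul_nonneg (Real.exp_pos _).le (by linarith)
  have hlim : Tendsto (fun x => Real.exp (-L * x) * w x) (𝓝[>] 0) (𝓝 0) := by
    have h1 : Tendsto (fun x => Real.exp (-L * x)) (𝓝[>] 0) (𝓝 (Real.exp (-L * 0))) :=
      (Continuous.tendsto (by fun_prop) 0).mono_left nhdsWithin_le_nhds
    simpa using h1.mul h0
  have hx2 : x₁ / 2 ∈ Ioo 0 x₁ := ⟨by linarith [hx₁.1], by linarith [hx₁.1]⟩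
  have : 0 ≤ Real.exp (-L * (x₁ / 2)) * w (x₁ / 2) := by
    refine le_of_tendsto hlim ?_
    filter_upwards [Ioo_mem_nhdsGT hx2.1] with z hz
    exact hmono ⟨hz.1, hz.2.trans hx2.2⟩ hx2 hz.2.le
  have := mul_neg_of_pos_of_neg (Real.exp_pos (-L * (x₁ / 2))) (hle _ hx2)
  linarith

/-- `exp (L x) w` is positive and nondecreasing, so its limit at `b` cannot be `0`. -/
lemma not_tendsto_zero_of_linear_growth {w w' : ℝ → ℝ} {a b L : ℝ} (hab : a < b)
    (hw : ∀ x ∈ Ioo a b, HasDerivAt w (w' x) x)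
    (hgrow : ∀ x ∈ Ioo a b, -(L * w x) ≤ w' x) (hpos : ∀ x ∈ Ioo a b, 0 < w x) :
    ¬ Tendsto w (𝓝[<] b) (𝓝 0) := by
  intro hlim0
  have hd : ∀ x ∈ Ioo a b, HasDerivAt (fun x => Real.exp (L * x) * w x)
      (Real.exp (L * x) * (w' x + L * w x)) x := fun x hx => by
    have h1 : HasDerivAt (fun x => Real.exp (L * x)) (Real.exp (L * x) * L) x := by
      simpa using ((hasDerivAt_id x).const_mul L).exp
    exact (h1.mul (hw x hx)).congr_deriv (by ring)
  have hmono : MonotoneOn (fun x => Real.exp (L * x) * w x) (Ioo a b) := by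
    refine monotoneOn_of_deriv_nonneg (convex_Ioo _ _)
      (fun x hx => (hd x hx).continuousAt.continuousWithinAt) ?_ ?_
    · rw [interior_Ioo]
      exact fun x hx => (hd x hx).differentiableAt.differentiableWithinAt
    · rw [interior_Ioo]
      intro x hx
      rw [(hd x hx).deriv]
      have := hgrow x hx
      exact mul_nonneg (Real.exp_pos _).le (by linarith)
  have hlim : Tendsto (fun x => Real.exp (L * x) * w x) (𝓝[<] b) (𝓝 0) := by
    have h1 : Tendsto (fun x => Real.exp (L * x)) (𝓝[<] b) (𝓝 (Real.exp (L * b))) :=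
      (Continuous.tendsto (by fun_prop) b).mono_left nhdsWithin_le_nhds
    simpa using h1.mul hlim0
  obtain ⟨c, hc⟩ := exists_between hab
  have h1 : Real.exp (L * c) * w c ≤ 0 := by
    refine ge_of_tendsto hlim ?_
    filter_upwards [Ioo_mem_nhdsLT hc.2] with z hz
    exact hmono hc ⟨hc.1.trans hz.1, hz.2⟩ hz.1.le
  have := mul_pos (Real.exp_pos (L * c)) (hpos c hc)
  linarith

/-! ### Comparison and uniqueness for the angle equation -/

/-- Strict comparison of a strict supersolution `u` and a subsolution `v` issuing from `0`. -/
lemma angle_comparison (hp : 1 < p) (hN : 2 < N) {u v u' v' : ℝ → ℝ} {c : ℝ} (hc : 0 < c)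
    (hu : ∀ x ∈ Ioo 0 (Real.pi / 2), HasDerivAt u (u' x) x)
    (hv : ∀ x ∈ Ioo 0 (Real.pi / 2), HasDerivAt v (v' x) x)
    (hu0 : Tendsto u (𝓝[>] 0) (𝓝 0)) (hv0 : Tendsto v (𝓝[>] 0) (𝓝 0))
    (h : ∀ x ∈ Ioo 0 (Real.pi / 2), c + (v' x - angleField p N κ x (v x)) ≤
      u' x - angleField p N κ x (u x)) :
    (∀ x ∈ Ioo 0 (Real.pi / 2), v x < u x) ∧
      ¬ Tendsto (fun x => u x - v x) (𝓝[<] (Real.pi / 2)) (𝓝 0) := by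
  obtain ⟨L, hL, hone⟩ := angleField_oneSided_curves (κ := κ) hp hN hu0 hv0
  have hpi := Real.pi_pos
  have hpos : ∀ x ∈ Ioo 0 (Real.pi / 2), 0 < u x - v x := by
    refine pos_of_linear_growth (L := L) hc (fun x hx => (hu x hx).sub (hv x hx))
      (fun x hx hle => ?_) (by simpa using hu0.sub hv0)
    have := (hone x hx).1 (by linarith)
    have := h x hx
    linarith
  refine ⟨fun x hx => sub_pos.1 (hpos x hx), ?_⟩
  obtain ⟨K, hK, hlip⟩ := angleField_lipschitz (N := N) (κ := κ) hp
  have hsub : Ioo (Real.pi / 4) (Real.pi / 2) ⊆ Ioo 0 (Real.pi / 2) :=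
    Ioo_subset_Ioo_left (by linarith)
  -- Away from `0` the field is Lipschitz, so the gap decays at most exponentially.
  refine not_tendsto_zero_of_linear_growth (a := Real.pi / 4)
    (L := K * (1 + (Real.pi / 4)⁻¹)) (by linarith)
    (fun x hx => (hu x (hsub hx)).sub (hv x (hsub hx))) (fun x hx => ?_)
    (fun x hx => hpos x (hsub hx))
  have hcot : |Real.cot x| ≤ (Real.pi / 4)⁻¹ := by
    rw [abs_of_nonneg (cot_nonneg_of_mem (hsub hx))]
    exact (cot_le_inv (hsub hx)).trans (inv_anti₀ (by positivity) hx.1.le)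
  have h1 : |angleField p N κ x (u x) - angleField p N κ x (v x)| ≤
      K * (1 + (Real.pi / 4)⁻¹) * (u x - v x) := by
    refine (hlip x (v x) (u x)).trans ?_
    rw [abs_of_pos (hpos x (hsub hx))]
    have := hpos x (hsub hx)
    gcongr
  have := (abs_le.1 h1).1
  have := h x (hsub hx)
  linarith

/-- The Lipschitz constant blows up at `0`, but the one-sided bound is enough: it makes `exp (-2 L
x) (u - v) ^ 2` nonincreasing, and this quantity tends to `0` at `0`. -/
lemma angle_unique (hp : 1 < p) (hN : 2 < N) {u v : ℝ → ℝ} {b : ℝ} (hb : b ≤ Real.pi / 2)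
    (hu : ∀ x ∈ Ioo 0 b, HasDerivAt u (angleField p N κ x (u x)) x)
    (hv : ∀ x ∈ Ioo 0 b, HasDerivAt v (angleField p N κ x (v x)) x)
    (hu0 : Tendsto u (𝓝[>] 0) (𝓝 0)) (hv0 : Tendsto v (𝓝[>] 0) (𝓝 0)) :
    EqOn u v (Ioo 0 b) := by
  obtain ⟨L, hL, hone⟩ := angleField_oneSided_curves (κ := κ) hp hN hu0 hv0
  set f : ℝ → ℝ := fun x => Real.exp (-(2 * L) * x) * (u x - v x) ^ 2 with hf
  have hd : ∀ x ∈ Ioo 0 b, HasDerivAt f (2 * Real.exp (-(2 * L) * x) *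
      ((u x - v x) * (angleField p N κ x (u x) - angleField p N κ x (v x))
        - L * (u x - v x) ^ 2)) x := fun x hx => by
    have h1 : HasDerivAt (fun x => Real.exp (-(2 * L) * x))
        (Real.exp (-(2 * L) * x) * (-(2 * L))) x := by
      simpa using ((hasDerivAt_id x).const_mul (-(2 * L))).exp
    exact (h1.mul (((hu x hx).sub (hv x hx)).pow 2)).congr_deriv (by simp; ring)
  have hanti : AntitoneOn f (Ioo 0 b) := by
    refine antitoneOn_of_deriv_nonpos (convex_Ioo _ _)
      (fun x hx => (hd x hx).continuousAt.continuousWithinAt) ?_ ?_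
    · rw [interior_Ioo]
      exact fun x hx => (hd x hx).differentiableAt.differentiableWithinAt
    · rw [interior_Ioo]
      intro x hx
      rw [(hd x hx).deriv]
      have hx' : x ∈ Ioo 0 (Real.pi / 2) := ⟨hx.1, hx.2.trans_le hb⟩
      refine mul_nonpos_of_nonneg_of_nonpos (by positivity) ?_
      rcases le_total (u x) (v x) with h | h
      · nlinarith [(hone x hx').1 h]
      · nlinarith [(hone x hx').2 h]
  have hlim : Tendsto f (𝓝[>] 0) (𝓝 0) := by
    have h1 : Tendsto (fun x => Real.exp (-(2 * L) * x)) (𝓝[>] 0)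
        (𝓝 (Real.exp (-(2 * L) * 0))) :=
      (Continuous.tendsto (by fun_prop) 0).mono_left nhdsWithin_le_nhds
    simpa [hf] using h1.mul ((hu0.sub hv0).pow 2)
  intro x hx
  have hle : f x ≤ 0 := by
    refine ge_of_tendsto hlim ?_
    filter_upwards [Ioo_mem_nhdsGT hx.1] with z hz
    exact hanti ⟨hz.1, hz.2.trans hx.2⟩ hx hz.2.le
  have hsq : (u x - v x) ^ 2 ≤ 0 := by
    by_contra! h
    exact hle.not_gt (mul_pos (Real.exp_pos _) h)
  exact sub_eq_zero.1 (pow_eq_zero_iff two_ne_zero |>.1 (le_antisymm hsq (sq_nonneg _)))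


/-! ### Solutions of the angle equation with `φ (π/2) = π/2` -/

lemma continuousOn_cot : ContinuousOn Real.cot (Ioo 0 Real.pi) := by
  have : Real.cot = fun x => Real.cos x / Real.sin x := funext Real.cot_eq_cos_div_sin
  rw [this]
  exact Real.continuous_cos.continuousOn.div Real.continuous_sin.continuousOn
    fun x hx => (Real.sin_pos_of_mem_Ioo hx).ne'

lemma exists_cot_bound {ε : ℝ} (hε : 0 < ε) :
    ∃ C, 0 ≤ C ∧ ∀ x ∈ Icc ε (Real.pi - ε), |Real.cot x| ≤ C := by
  have hsub : Icc ε (Real.pi - ε) ⊆ Ioo 0 Real.pi := Icc_subset_Ioo hε (by linarith)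
  obtain ⟨C, hC⟩ := isCompact_Icc.exists_bound_of_continuousOn (continuousOn_cot.mono hsub)
  exact ⟨max C 0, le_max_right _ _, fun x hx => (hC x hx).trans (le_max_left _ _)⟩

lemma abs_regular_div_angleDen_le (hp : 1 < p) (θ : ℝ) :
    |κ * (p - 1) + (p - N) * Real.cos θ ^ 2| / angleDen p θ ≤
      (|κ| * (p - 1) + |p - N|) / min 1 (p - 1) := by
  have hm := min_one_sub_pos hp
  have h1 : |κ * (p - 1) + (p - N) * Real.cos θ ^ 2| ≤ |κ| * (p - 1) + |p - N| := by
    refine (abs_add_le _ _).trans ?_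
    rw [abs_mul, abs_mul, abs_of_pos (by linarith : 0 < p - 1),
      abs_of_nonneg (sq_nonneg (Real.cos θ))]
    gcongr
    exact mul_le_of_le_one_right (abs_nonneg _) (Real.cos_sq_le_one θ)
  have := min_le_angleDen (p := p) θ
  gcongr

lemma abs_angleField_le (hp : 1 < p) (x θ : ℝ) :
    |angleField p N κ x θ| ≤
      (|κ| * (p - 1) + |p - N| + |N - 2| * |Real.cot x|) / min 1 (p - 1) := by
  have hm := min_one_sub_pos hp
  unfold angleField
  rw [abs_div, abs_of_pos (angleDen_pos hp θ)]
  have h1 : |κ * (p - 1) + (p - N) * Real.cos θ ^ 2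
      - (N - 2) * (Real.sin θ * Real.cos θ) * Real.cot x| ≤
      |κ| * (p - 1) + |p - N| + |N - 2| * |Real.cot x| := by
    refine (abs_sub _ _).trans (add_le_add ((abs_add_le _ _).trans ?_) ?_)
    · rw [abs_mul, abs_mul, abs_of_pos (by linarith : 0 < p - 1),
      abs_of_nonneg (sq_nonneg (Real.cos θ))]
      gcongr
      exact mul_le_of_le_one_right (abs_nonneg _) (Real.cos_sq_le_one θ)
    · rw [abs_mul, abs_mul, abs_mul]
      gcongr
      refine mul_le_of_le_one_right (abs_nonneg _) ?_
      exact mul_le_one₀ (Real.abs_sin_le_one _) (abs_nonneg _) (Real.abs_cos_le_one _)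
  have := min_le_angleDen (p := p) θ
  gcongr

/-- For these angles the `cot` term has a favourable sign and can be dropped, so the bound is
uniform in `x`, unlike that of `abs_angleField_le`. -/
lemma angleField_le_of_mem (hp : 1 < p) (hN : 2 < N) {x θ : ℝ} (hx : x ∈ Ioo 0 (Real.pi / 2))
    (hθ : θ ∈ Icc 0 (Real.pi / 2)) :
    angleField p N κ x θ ≤ (|κ| * (p - 1) + |p - N|) / min 1 (p - 1) := by
  refine le_trans ?_ (abs_regular_div_angleDen_le hp θ)
  unfold angleField
  have hD := angleDen_pos hp θ
  gcongr
  have : 0 ≤ (N - 2) * (Real.sin θ * Real.cos θ) * Real.cot x :=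
    mul_nonneg (mul_nonneg (by linarith) (mul_nonneg
      (Real.sin_nonneg_of_nonneg_of_le_pi hθ.1 (by linarith [hθ.2, Real.pi_pos]))
      (Real.cos_nonneg_of_mem_Icc ⟨by linarith [hθ.1, Real.pi_pos], hθ.2⟩)))
      (cot_nonneg_of_mem hx)
  linarith [le_abs_self (κ * (p - 1) + (p - N) * Real.cos θ ^ 2)]

lemma le_angleField_neg_of_mem (hp : 1 < p) (hN : 2 < N) {x θ : ℝ}
    (hx : x ∈ Ioo 0 (Real.pi / 2)) (hθ : θ ∈ Icc 0 (Real.pi / 2)) :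
    -((|κ| * (p - 1) + |p - N|) / min 1 (p - 1)) ≤ angleField p N κ x (-θ) := by
  refine le_trans (neg_le_neg (abs_regular_div_angleDen_le hp (-θ))) ?_
  unfold angleField
  have hD := angleDen_pos hp (-θ)
  rw [← neg_div]
  gcongr
  have : 0 ≤ (N - 2) * (Real.sin θ * Real.cos θ) * Real.cot x :=
    mul_nonneg (mul_nonneg (by linarith) (mul_nonneg
      (Real.sin_nonneg_of_nonneg_of_le_pi hθ.1 (by linarith [hθ.2, Real.pi_pos]))
      (Real.cos_nonneg_of_mem_Icc ⟨by linarith [hθ.1, Real.pi_pos], hθ.2⟩)))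
      (cot_nonneg_of_mem hx)
  rw [Real.sin_neg, Real.cos_neg]
  linarith [neg_abs_le (κ * (p - 1) + (p - N) * Real.cos θ ^ 2)]

lemma angleField_lipschitzWith (hp : 1 < p) {ε : ℝ} (hε : 0 < ε) :
    ∃ K : NNReal, ∀ x ∈ Icc ε (Real.pi - ε), LipschitzWith K (angleField p N κ x) := by
  obtain ⟨K, hK, hlip⟩ := angleField_lipschitz (N := N) (κ := κ) hp
  obtain ⟨C, hC, hcot⟩ := exists_cot_bound hε
  refine ⟨(K * (1 + C)).toNNReal, fun x hx => LipschitzWith.of_dist_le_mul fun a b => ?_⟩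
  rw [Real.dist_eq, Real.dist_eq]
  refine (hlip x b a).trans ?_
  have := hcot x hx
  rw [Real.coe_toNNReal _ (by positivity)]
  gcongr

lemma exists_angle_on_Ioo (hp : 1 < p) {ε : ℝ} (hε : 0 < ε) (hε2 : ε < Real.pi / 2) :
    ∃ α : ℝ → ℝ, α (Real.pi / 2) = Real.pi / 2 ∧
      ∀ t ∈ Ioo ε (Real.pi - ε), HasDerivAt α (angleField p N κ t (α t)) t := by
  obtain ⟨K, hK⟩ := angleField_lipschitzWith (N := N) (κ := κ) hp hε
  obtain ⟨C, hC, hcot⟩ := exists_cot_bound hε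
  have hm := min_one_sub_pos hp
  have hp1 : 0 < p - 1 := by linarith
  set L : ℝ := (|κ| * (p - 1) + |p - N| + |N - 2| * C) / min 1 (p - 1)
  have hL : 0 ≤ L := by positivity
  have hmem : Real.pi / 2 ∈ Icc ε (Real.pi - ε) := ⟨hε2.le, by linarith⟩
  -- The field is bounded by `L` for all angles, so a ball of radius `L π` contains the solution
  -- over the whole interval and no continuation argument is needed.
  have hPL : IsPicardLindelof (angleField p N κ) (⟨Real.pi / 2, hmem⟩ : Icc ε (Real.pi - ε))
      (Real.pi / 2) (L * Real.pi).toNNReal 0 L.toNNReal K :=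
    { lipschitzOnWith := fun t ht => (hK t ht).lipschitzOnWith
      continuousOn := fun θ _ => by
        have := continuousOn_cot.mono (Icc_subset_Ioo hε (by linarith) :
          Icc ε (Real.pi - ε) ⊆ Ioo 0 Real.pi)
        unfold angleField
        exact (continuousOn_const.sub (continuousOn_const.mul this)).div_const _
      norm_le := fun t ht θ _ => by
        refine (abs_angleField_le hp t θ).trans ?_
        have := hcot t ht
        rw [Real.coe_toNNReal _ hL]
        simp only [L]
        gcongr
      mul_max_le := by
        rw [Real.coe_toNNReal _ hL, Real.coe_toNNReal _ (by positivity), NNReal.coe_zero, sub_zero]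
        gcongr
        exact max_le (by linarith) (by linarith) }
  obtain ⟨α, h1, h2⟩ := hPL.exists_eq_forall_mem_Icc_hasDerivWithinAt₀
  exact ⟨α, h1, fun t ht => (h2 t (Ioo_subset_Icc_self ht)).hasDerivAt (Icc_mem_nhds ht.1 ht.2)⟩

lemma angle_unique_on_Ioo (hp : 1 < p) {ε : ℝ} (hε : 0 < ε) {u v : ℝ → ℝ} {t₀ : ℝ}
    (ht₀ : t₀ ∈ Ioo ε (Real.pi - ε))
    (hu : ∀ x ∈ Ioo ε (Real.pi - ε), HasDerivAt u (angleField p N κ x (u x)) x)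
    (hv : ∀ x ∈ Ioo ε (Real.pi - ε), HasDerivAt v (angleField p N κ x (v x)) x)
    (h : u t₀ = v t₀) : EqOn u v (Ioo ε (Real.pi - ε)) := by
  obtain ⟨K, hK⟩ := angleField_lipschitzWith (N := N) (κ := κ) hp hε
  exact ODE_solution_unique_of_mem_Ioo (s := fun _ => univ) (K := K)
    (fun t ht => (hK t (Ioo_subset_Icc_self ht)).lipschitzOnWith) ht₀
    (fun t ht => ⟨hu t ht, mem_univ _⟩) (fun t ht => ⟨hv t ht, mem_univ _⟩) h

lemma exists_angle_terminal (hp : 1 < p) :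
    ∃ φ : ℝ → ℝ, φ (Real.pi / 2) = Real.pi / 2 ∧
      ∀ t ∈ Ioo 0 Real.pi, HasDerivAt φ (angleField p N κ t (φ t)) t := by
  have hpi := Real.pi_pos
  -- The conditions on `ε` stand inside the existential so that `choose` yields a family indexed by
  -- all reals.
  have hex : ∀ ε : ℝ, ∃ α : ℝ → ℝ, 0 < ε → ε < Real.pi / 2 → α (Real.pi / 2) = Real.pi / 2 ∧
      ∀ t ∈ Ioo ε (Real.pi - ε), HasDerivAt α (angleField p N κ t (α t)) t := fun ε => by
    by_cases h : 0 < ε ∧ ε < Real.pi / 2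
    · obtain ⟨α, hα⟩ := exists_angle_on_Ioo (N := N) (κ := κ) hp h.1 h.2
      exact ⟨α, fun _ _ => hα⟩
    · exact ⟨0, fun h1 h2 => absurd ⟨h1, h2⟩ h⟩
  choose α hα using hex
  have hagree : ∀ ε₁ ε₂, 0 < ε₁ → ε₁ ≤ ε₂ → ε₂ < Real.pi / 2 →
      EqOn (α ε₁) (α ε₂) (Ioo ε₂ (Real.pi - ε₂)) := fun ε₁ ε₂ h1 h12 h2 => by
    obtain ⟨i1, d1⟩ := hα ε₁ h1 (by linarith)
    obtain ⟨i2, d2⟩ := hα ε₂ (by linarith) h2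
    exact angle_unique_on_Ioo hp (h1.trans_le h12) (t₀ := Real.pi / 2)
      ⟨h2, by linarith⟩ (fun x hx => d1 x ⟨by linarith [hx.1], by linarith [hx.2]⟩) d2
      (i1.trans i2.symm)
  have hagree' : ∀ ε₁ ε₂ x, 0 < ε₁ → 0 < ε₂ → ε₁ < Real.pi / 2 → ε₂ < Real.pi / 2 →
      x ∈ Ioo ε₁ (Real.pi - ε₁) → x ∈ Ioo ε₂ (Real.pi - ε₂) → α ε₁ x = α ε₂ x := by
    intro ε₁ ε₂ x h1 h2 h1' h2' hx1 hx2
    rcases le_total ε₁ ε₂ with h | h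
    · exact hagree _ _ h1 h h2' hx2
    · exact (hagree _ _ h2 h h1' hx1).symm
  -- Half the distance to the endpoints: the glued solution at `x` uses the interval with `ε = e x`,
  -- and uniqueness makes the choices agree.
  set e : ℝ → ℝ := fun x => min x (Real.pi - x) / 2
  have he : ∀ x ∈ Ioo 0 Real.pi, 0 < e x ∧ e x < Real.pi / 2 ∧
      x ∈ Ioo (e x) (Real.pi - e x) := fun x hx => by
    have h0 : 0 < min x (Real.pi - x) := lt_min hx.1 (by linarith [hx.2])
    have h1 := min_le_left x (Real.pi - x)
    have h2 := min_le_right x (Real.pi - x)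
    have := hx.1
    have := hx.2
    simp only [e]
    exact ⟨by linarith, by linarith, by linarith, by linarith⟩
  have hhalf : Real.pi / 2 ∈ Ioo 0 Real.pi := ⟨by linarith, by linarith⟩
  refine ⟨fun x => α (e x) x, (hα _ (he _ hhalf).1 (he _ hhalf).2.1).1, fun t ht => ?_⟩
  obtain ⟨h1, h2, h3⟩ := he t ht
  refine ((hα _ h1 h2).2 t h3).congr_of_eventuallyEq ?_
  filter_upwards [Ioo_mem_nhds h3.1 h3.2] with x hx
  have hx' : x ∈ Ioo 0 Real.pi := ⟨h1.trans hx.1, by linarith [hx.2]⟩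
  exact hagree' _ _ _ (he x hx').1 h1 (he x hx').2.1 h2 (he x hx').2.2 hx

lemma angle_continuousAt_param (hp : 1 < p) {φ : ℝ → ℝ → ℝ}
    (hφ0 : ∀ κ, φ κ (Real.pi / 2) = Real.pi / 2)
    (hφ : ∀ κ, ∀ t ∈ Ioo 0 Real.pi, HasDerivAt (φ κ) (angleField p N κ t (φ κ t)) t)
    {x : ℝ} (hx : x ∈ Ioo 0 (Real.pi / 2)) : Continuous fun κ => φ κ x := by
  rw [continuous_iff_continuousAt]
  intro κ
  have hpi := Real.pi_pos
  have hm := min_one_sub_pos hp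
  obtain ⟨K, hK⟩ := angleField_lipschitzWith (N := N) (κ := κ) hp hx.1
  -- Reversing time turns the common terminal value into an initial value at `-π/2`. Grönwall then
  -- treats `φ κ'` as an approximate solution for `κ`, with error proportional to `|κ' - κ|`.
  have hrev : ∀ κ', ∀ t ∈ Icc (-(Real.pi / 2)) (-x), HasDerivAt (fun t => φ κ' (-t))
      (-angleField p N κ' (-t) (φ κ' (-t))) t := fun κ' t ht => by
    have := (hφ κ' (-t) ⟨by linarith [ht.2, hx.1], by linarith [ht.1]⟩).comp t (hasDerivAt_neg t)
    simpa [Function.comp_def] using this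
  have hbound : ∀ κ', dist (φ κ' x) (φ κ x) ≤
      gronwallBound 0 K (|κ' - κ| * ((p - 1) / min 1 (p - 1)) + 0) (-x - -(Real.pi / 2)) := by
    intro κ'
    have := dist_le_of_approx_trajectories_ODE_of_mem (K := K) (s := fun _ => univ)
      (v := fun t θ => -angleField p N κ (-t) θ) (a := -(Real.pi / 2)) (b := -x)
      (f := fun t => φ κ' (-t)) (g := fun t => φ κ (-t))
      (f' := fun t => -angleField p N κ' (-t) (φ κ' (-t)))
      (g' := fun t => -angleField p N κ (-t) (φ κ (-t)))
      (εf := |κ' - κ| * ((p - 1) / min 1 (p - 1))) (εg := 0) (δ := 0)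
      (fun t ht => by
        have := (hK (-t) ⟨by linarith [ht.2], by linarith [ht.1, hx.2]⟩).neg
        exact this.lipschitzOnWith)
      (fun t ht => (hrev κ' t ht).continuousAt.continuousWithinAt)
      (fun t ht => (hrev κ' t (Ico_subset_Icc_self ht)).hasDerivWithinAt)
      (fun t _ => by
        rw [dist_neg_neg, Real.dist_eq]
        have : angleField p N κ' (-t) (φ κ' (-t)) - angleField p N κ (-t) (φ κ' (-t)) =
            (κ' - κ) * ((p - 1) / angleDen p (φ κ' (-t))) := by
          unfold angleField
          have := (angleDen_pos hp (φ κ' (-t))).ne'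
          field_simp
          ring
        have hp1 : 0 < p - 1 := by linarith
        have hD := angleDen_pos hp (φ κ' (-t))
        rw [this, abs_mul, abs_of_pos (div_pos hp1 hD)]
        have := min_le_angleDen (p := p) (φ κ' (-t))
        gcongr)
      (fun _ _ => mem_univ _)
      (fun t ht => (hrev κ t ht).continuousAt.continuousWithinAt)
      (fun t ht => (hrev κ t (Ico_subset_Icc_self ht)).hasDerivWithinAt)
      (fun t _ => by simp) (fun _ _ => mem_univ _) (by simp [hφ0])
      (-x) ⟨by linarith [hx.2], le_rfl⟩
    simpa using this
  rw [ContinuousAt, tendsto_iff_dist_tendsto_zero]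
  refine squeeze_zero (fun _ => dist_nonneg) hbound ?_
  have h1 : Continuous fun κ' => gronwallBound 0 K
      (|κ' - κ| * ((p - 1) / min 1 (p - 1)) + 0) (-x - -(Real.pi / 2)) :=
    (gronwallBound_continuous_ε 0 K _).comp (by fun_prop)
  simpa [gronwallBound_ε0_δ0] using h1.tendsto κ


/-! ### Shooting -/

/-- For large `κ` the line `θ = x`, which joins `0` to `π/2`, is a strict subsolution. On it `sin x
cot x = cos x`, so the singularity cancels; numerator minus `angleDen` minus `p - 1` equals `(κ -
2)(p - 1) + 2(p - N) cos² x`, which explains the threshold. -/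
lemma angleField_diag (hp : 1 < p) {κ x : ℝ} (hx : x ∈ Ioo 0 Real.pi)
    (hκ : 2 + 2 * |p - N| / (p - 1) ≤ κ) :
    (p - 1) / p + 1 ≤ angleField p N κ x x := by
  have hp1 : 0 < p - 1 := by linarith
  have hD := angleDen_pos hp x
  have hs := Real.sin_pos_of_mem_Ioo hx
  have hκ' : 2 * (p - 1) + 2 * |p - N| ≤ κ * (p - 1) := by
    have := mul_le_mul_of_nonneg_right hκ hp1.le
    rwa [add_mul, div_mul_cancel₀ _ hp1.ne'] at this
  have h1 : (p - 1) / p + 1 ≤ (p - 1) / angleDen p x + 1 := by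
    have := angleDen_le hp x
    gcongr
  refine h1.trans ?_
  unfold angleField
  rw [div_add_one hD.ne', Real.cot_eq_cos_div_sin]
  have h2 : (N - 2) * (Real.sin x * Real.cos x) * (Real.cos x / Real.sin x) =
      (N - 2) * Real.cos x ^ 2 := by
    field_simp
  rw [h2]
  gcongr
  unfold angleDen
  rw [Real.sin_sq]
  have hc0 := sq_nonneg (Real.cos x)
  have hc1 := Real.cos_sq_le_one x
  have h3 : -|p - N| ≤ (p - N) * Real.cos x ^ 2 := by
    refine (abs_le.1 ?_).1
    rw [abs_mul, abs_of_nonneg hc0]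
    exact mul_le_of_le_one_right (abs_nonneg _) hc1
  nlinarith

lemma angleField_zero (x : ℝ) : angleField p N κ x 0 = κ * (p - 1) + p - N := by
  simp [angleField, angleDen]
  ring

lemma angleField_pi_div_two (hp : 1 < p) (x : ℝ) : angleField p N κ x (Real.pi / 2) = κ := by
  have : p - 1 ≠ 0 := by linarith
  simp [angleField, angleDen, this]

lemma tendsto_zero_of_abs_le {φ : ℝ → ℝ} {C x₀ : ℝ} (hx₀ : 0 < x₀)
    (h : ∀ x ∈ Ioo 0 x₀, |φ x| ≤ C * x) : Tendsto φ (𝓝[>] 0) (𝓝 0) := by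
  have hC : Tendsto (fun x : ℝ => C * x) (𝓝[>] 0) (𝓝 0) := by
    have : Tendsto (fun x : ℝ => C * x) (𝓝 0) (𝓝 (C * 0)) := Continuous.tendsto (by fun_prop) 0
    rw [mul_zero] at this
    exact this.mono_left nhdsWithin_le_nhds
  refine squeeze_zero_norm' ?_ hC
  filter_upwards [Ioo_mem_nhdsGT hx₀] with x hx using h x hx

lemma angle_tendsto_pi_div_two {φ : ℝ → ℝ} (hφ0 : φ (Real.pi / 2) = Real.pi / 2)
    (hφ : ∀ t ∈ Ioo 0 Real.pi, HasDerivAt φ (angleField p N κ t (φ t)) t) :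
    Tendsto φ (𝓝[<] (Real.pi / 2)) (𝓝 (Real.pi / 2)) := by
  have := (hφ (Real.pi / 2) ⟨by linarith [Real.pi_pos], by linarith [Real.pi_pos]⟩).continuousAt
  have h : Tendsto φ (𝓝 (Real.pi / 2)) (𝓝 (φ (Real.pi / 2))) := this
  rw [hφ0] at h
  exact h.mono_left nhdsWithin_le_nhds

/-- A solution of the angle equation joining `0` to `π/2` forces `k` into the interval
`I` of the theorem. -/
lemma lt_of_angle_solution (hp : 1 < p) (hN : 2 < N) {φ : ℝ → ℝ}
    (hφ : ∀ t ∈ Ioo 0 (Real.pi / 2), HasDerivAt φ (angleField p N κ t (φ t)) t)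
    (hend : Tendsto φ (𝓝[<] (Real.pi / 2)) (𝓝 (Real.pi / 2)))
    (h0 : Tendsto φ (𝓝[>] 0) (𝓝 0)) : N - p < κ * (p - 1) := by
  have hpi := Real.pi_pos
  by_contra! hle
  -- Otherwise the zero function is a strict supersolution, or a solution in the case of equality,
  -- and keeps `φ` nonpositive.
  have hnonpos : ∀ x ∈ Ioo 0 (Real.pi / 2), φ x ≤ 0 := by
    rcases hle.lt_or_eq with h | h
    · intro x hx
      refine ((angle_comparison (κ := κ) hp hN (u := fun _ => 0) (u' := fun _ => 0)
        (c := -(κ * (p - 1) + p - N)) (by linarith) (fun x _ => hasDerivAt_const x 0) hφ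
        tendsto_const_nhds h0 (fun x _ => ?_)).1 x hx).le
      rw [angleField_zero]
      linarith
    · intro x hx
      refine (angle_unique (κ := κ) hp hN le_rfl hφ (v := fun _ => 0) (fun x _ => ?_) h0
        tendsto_const_nhds hx).le
      rw [angleField_zero, show κ * (p - 1) + p - N = 0 by linarith]
      exact hasDerivAt_const x 0
  have : Real.pi / 2 ≤ 0 := le_of_tendsto hend (by
    filter_upwards [Ioo_mem_nhdsLT (by linarith : (0 : ℝ) < Real.pi / 2)] with x hx
    exact hnonpos x hx)
  linarith

/-- For a small parameter, the solution ending at `π/2` exceeds every line near `0`. -/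
lemma exists_lower_param (hp : 1 < p) (hN : 2 < N) {φ : ℝ → ℝ → ℝ}
    (hφ0 : ∀ κ, φ κ (Real.pi / 2) = Real.pi / 2)
    (hφ : ∀ κ, ∀ t ∈ Ioo 0 Real.pi, HasDerivAt (φ κ) (angleField p N κ t (φ κ t)) t) :
    ∃ κl, κl ≤ 2 + 2 * |p - N| / (p - 1) ∧
      (∀ C x₀, 0 < x₀ → C * x₀ ≤ Real.pi / 2 → x₀ ≤ Real.pi / 2 → 0 < C →
        ∃ x ∈ Ioo 0 x₀, C * x < φ κl x) ∧
      (∀ κ, κl ≤ κ → Tendsto (φ κ) (𝓝[>] 0) (𝓝 0) → 0 < κ) := by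
  have hpi := Real.pi_pos
  have hp1 : 0 < p - 1 := by linarith
  have habs : 0 ≤ |p - N| / (p - 1) := by positivity
  have hhalf : Real.pi / 2 ∈ Ioo 0 Real.pi := ⟨by linarith, by linarith⟩
  have hsub : Ioo 0 (Real.pi / 2) ⊆ Ioo 0 Real.pi := Ioo_subset_Ioo_right (by linarith)
  rcases lt_or_ge p N with hpN | hpN
  -- This `κl` violates the necessary condition `lt_of_angle_solution`, and makes the field at angle
  -- `0` equal to `-(p - 1)`. Hence `φ` stays positive, and lying under a line would force the
  -- forbidden limit `0`.
  · have hκl : ((N - p) / (p - 1) - 1) * (p - 1) = N - p - (p - 1) := by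
      field_simp
    refine ⟨(N - p) / (p - 1) - 1, ?_, fun C x₀ hx₀ _ hx₀' _ => ?_, fun κ _ h0 => ?_⟩
    · rw [abs_sub_comm, abs_of_pos (by linarith), mul_div_assoc]
      have : 0 < (N - p) / (p - 1) := div_pos (by linarith) hp1
      linarith
    · by_contra! hcon
      set κl := (N - p) / (p - 1) - 1
      have hpos : ∀ x ∈ Ioo 0 (Real.pi / 2), 0 < φ κl x := by
        intro x hx
        by_contra! hle
        have := pos_of_deriv_pos_at_zeros (v := fun x => -φ κl x)
          (fun x hx => (hφ κl x hx).neg) (fun x hx hz => by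
            rw [neg_eq_zero] at hz
            rw [hz, angleField_zero]
            linarith) (hsub hx) hhalf hx.2 (by simpa using hle)
        rw [hφ0] at this
        linarith
      have h0 : Tendsto (φ κl) (𝓝[>] 0) (𝓝 0) :=
        tendsto_zero_of_abs_le hx₀ (C := C) fun x hx => by
          rw [abs_of_pos (hpos x ⟨hx.1, hx.2.trans_le hx₀'⟩)]
          exact hcon x hx
      have := lt_of_angle_solution hp hN (fun t ht => hφ κl t (hsub ht))
        (angle_tendsto_pi_div_two (hφ0 κl) (hφ κl)) h0
      linarith
    · have := lt_of_angle_solution hp hN (fun t ht => hφ κ t (hsub ht))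
        (angle_tendsto_pi_div_two (hφ0 κ) (hφ κ)) h0
      by_contra! h
      nlinarith
  -- If `N ≤ p`, the parameter `0` serves: the field vanishes at angle `π/2`, so the solution is
  -- constant.
  · have hconst : ∀ x ∈ Ioo 0 (Real.pi / 2), φ 0 x = Real.pi / 2 := by
      intro x hx
      refine angle_unique_on_Ioo (κ := 0) hp (ε := x / 2) (by linarith [hx.1])
        (t₀ := Real.pi / 2) (v := fun _ => Real.pi / 2)
        ⟨by linarith [hx.1, hx.2], by linarith [hx.2]⟩
        (fun t ht => hφ 0 t ⟨by linarith [ht.1, hx.1], by linarith [ht.2, hx.1]⟩)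
        (fun t _ => ?_) (hφ0 0) ⟨by linarith [hx.1], by linarith [hx.2]⟩
      rw [angleField_pi_div_two hp]
      exact hasDerivAt_const _ _
    refine ⟨0, by rw [mul_div_assoc]; linarith, fun C x₀ hx₀ hC hx₀' hC0 => ?_,
      fun κ hκ h0 => ?_⟩
    · refine ⟨x₀ / 2, ⟨by linarith, by linarith⟩, ?_⟩
      rw [hconst _ ⟨by linarith, by linarith⟩]
      nlinarith
    · refine hκ.lt_of_ne fun h => ?_
      subst h
      have : Tendsto (φ 0) (𝓝[>] 0) (𝓝 (Real.pi / 2)) := by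
        refine tendsto_const_nhds.congr' ?_
        filter_upwards [Ioo_mem_nhdsGT (by linarith : (0 : ℝ) < Real.pi / 2)] with x hx
        exact (hconst x hx).symm
      have := tendsto_nhds_unique h0 this
      linarith

/-- For a large parameter, the solution ending at `π/2` becomes very negative near `0`. -/
lemma exists_lt_neg_of_upper_param (hp : 1 < p) (hN : 2 < N) {φ : ℝ → ℝ}
    (hκ : 2 + 2 * |p - N| / (p - 1) ≤ κ) (hφ0 : φ (Real.pi / 2) = Real.pi / 2)
    (hφ : ∀ t ∈ Ioo 0 Real.pi, HasDerivAt φ (angleField p N κ t (φ t)) t)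
    {C x₀ : ℝ} (hC : 1 ≤ C) (hx₀ : 0 < x₀) (hx₀' : x₀ ≤ Real.pi / 2) :
    ∃ x ∈ Ioo 0 x₀, φ x < -(C * x) := by
  have hpi := Real.pi_pos
  have hp1 : 0 < p - 1 := by linarith
  have hc : 0 < (p - 1) / p := div_pos hp1 (by linarith)
  have hhalf : Real.pi / 2 ∈ Ioo 0 Real.pi := ⟨by linarith, by linarith⟩
  have hsub : Ioo 0 (Real.pi / 2) ⊆ Ioo 0 Real.pi := Ioo_subset_Ioo_right (by linarith)
  by_contra! hcon
  -- `φ - x` crosses zero only upwards and vanishes at `π/2`. With the assumed lower bound this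
  -- gives `φ → 0`, and comparison with the subsolution `x` then yields the opposite inequality.
  have hlt : ∀ x ∈ Ioo 0 (Real.pi / 2), φ x < x := by
    intro x hx
    by_contra! hle
    have := pos_of_deriv_pos_at_zeros (v := fun x => φ x - x)
      (fun x hx => (hφ x hx).sub (hasDerivAt_id x)) (fun x hx hz => by
        rw [sub_eq_zero] at hz
        have := angleField_diag (N := N) hp hx hκ
        rw [hz]
        linarith) (hsub hx) hhalf hx.2 (by simpa using hle)
    rw [hφ0] at this
    linarith
  have h0 : Tendsto φ (𝓝[>] 0) (𝓝 0) := by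
    refine tendsto_zero_of_abs_le hx₀ (C := C) fun x hx => abs_le.2 ⟨hcon x hx, ?_⟩
    have := hlt x ⟨hx.1, hx.2.trans_le hx₀'⟩
    nlinarith [hx.1]
  have hid : Tendsto (fun x : ℝ => x) (𝓝[>] 0) (𝓝 0) := tendsto_id.mono_left nhdsWithin_le_nhds
  have hmem : Real.pi / 4 ∈ Ioo 0 (Real.pi / 2) := ⟨by linarith, by linarith⟩
  have := (angle_comparison (κ := κ) hp hN hc (fun t ht => hφ t (hsub ht))
    (fun t _ => hasDerivAt_id t) h0 hid (fun x hx => by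
      have := angleField_diag (N := N) hp (hsub hx) hκ
      simp only [id]
      linarith)).1 _ hmem
  exact absurd this (hlt _ hmem).not_gt

/-- Near `0`, the solution cannot be above the line of slope `C` at one point and below the line
of slope `-C` at another one. -/
lemma not_above_and_below (hp : 1 < p) (hN : 2 < N) {φ : ℝ → ℝ} {C x₀ y z : ℝ}
    (hC : (|κ| * (p - 1) + |p - N|) / min 1 (p - 1) < C)
    (hC0 : 0 < C) (hx₀ : C * x₀ ≤ Real.pi / 2) (hx₀' : x₀ ≤ Real.pi / 2)
    (hφ : ∀ t ∈ Ioo 0 x₀, HasDerivAt φ (angleField p N κ t (φ t)) t)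
    (hy : y ∈ Ioo 0 x₀) (hz : z ∈ Ioo 0 x₀) (hya : C * y < φ y) : -(C * z) ≤ φ z := by
  by_contra! hzb
  have hline : ∀ x ∈ Ioo 0 x₀, C * x ∈ Icc 0 (Real.pi / 2) := fun x hx =>
    ⟨by have := hx.1; positivity, le_trans (by have := hx.2; gcongr) hx₀⟩
  have hmem : ∀ x ∈ Ioo 0 x₀, x ∈ Ioo 0 (Real.pi / 2) := fun x hx =>
    ⟨hx.1, hx.2.trans_le hx₀'⟩
  have hlin : ∀ x : ℝ, HasDerivAt (fun x => C * x) C x := fun x => by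
    simpa using (hasDerivAt_id x).const_mul C
  -- Going left, a solution above `C x` or below `-C x` stays there, since it can cross these lines
  -- only towards the strip between them as `x` increases. At `s` both would hold.
  obtain ⟨s, hs0, hsy, hsz⟩ : ∃ s, 0 < s ∧ s < y ∧ s < z := by
    obtain ⟨s, hs0, hs⟩ := exists_between (lt_min hy.1 hz.1)
    exact ⟨s, hs0, hs.trans_le (min_le_left _ _), hs.trans_le (min_le_right _ _)⟩
  have hs : s ∈ Ioo 0 x₀ := ⟨hs0, hsy.trans hy.2⟩
  have h1 : C * s < φ s := by
    by_contra! hle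
    have := pos_of_deriv_pos_at_zeros (v := fun x => C * x - φ x)
      (fun x hx => (hlin x).sub (hφ x hx)) (fun x hx h0 => by
        rw [sub_eq_zero] at h0
        rw [← h0]
        have := angleField_le_of_mem (κ := κ) hp hN (hmem x hx) (hline x hx)
        linarith) hs hy hsy (by simpa using hle)
    linarith
  have h2 : φ s < -(C * s) := by
    by_contra! hle
    have := pos_of_deriv_pos_at_zeros (v := fun x => φ x + C * x)
      (fun x hx => (hφ x hx).add (hlin x)) (fun x hx h0 => by
        rw [add_eq_zero_iff_eq_neg] at h0
        rw [h0]
        have := le_angleField_neg_of_mem (κ := κ) hp hN (hmem x hx) (hline x hx)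
        linarith) hs hz hsz (by linarith)
    linarith
  have : 0 < C * s := by positivity
  linarith

theorem exists_angle_solution (hp : 1 < p) (hN : 2 < N) :
    ∃ κ, ∃ φ : ℝ → ℝ, 0 < κ ∧ N - p < κ * (p - 1) ∧
      (∀ t ∈ Ioo 0 Real.pi, HasDerivAt φ (angleField p N κ t (φ t)) t) ∧
      φ (Real.pi / 2) = Real.pi / 2 ∧ ∃ C x₀, 0 < x₀ ∧ ∀ x ∈ Ioo 0 x₀, |φ x| ≤ C * x := by
  have hpi := Real.pi_pos
  have hp1 : 0 < p - 1 := by linarith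
  have hm := min_one_sub_pos hp
  have hex : ∀ κ, ∃ φ : ℝ → ℝ, φ (Real.pi / 2) = Real.pi / 2 ∧
      ∀ t ∈ Ioo 0 Real.pi, HasDerivAt φ (angleField p N κ t (φ t)) t :=
    fun κ => exists_angle_terminal hp
  choose φ hφ0 hφ using hex
  obtain ⟨κl, hle, hlow, hposκ⟩ := exists_lower_param hp hN hφ0 hφ
  set κu := 2 + 2 * |p - N| / (p - 1)
  -- A slope that works for every `κ` in `[κl, κu]`; the `+ 1` provides strictness and `1 ≤ C`.
  set C := ((|κl| + |κu|) * (p - 1) + |p - N|) / min 1 (p - 1) + 1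
  have hC1 : 1 ≤ C := by
    have : 0 ≤ ((|κl| + |κu|) * (p - 1) + |p - N|) / min 1 (p - 1) := by positivity
    linarith
  have hC0 : 0 < C := by linarith
  have hCκ : ∀ κ ∈ Icc κl κu, (|κ| * (p - 1) + |p - N|) / min 1 (p - 1) < C := by
    intro κ hκ
    have : |κ| ≤ |κl| + |κu| := by
      rcases abs_cases κ with h | h <;> rcases abs_cases κl with h' | h' <;>
        rcases abs_cases κu with h'' | h'' <;> linarith [hκ.1, hκ.2]
    refine lt_add_of_le_of_pos ?_ one_pos
    gcongr
  set x₀ := Real.pi / 2 / C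
  have hx₀ : 0 < x₀ := by positivity
  have hCx₀ : C * x₀ = Real.pi / 2 := mul_div_cancel₀ _ hC0.ne'
  have hx₀' : x₀ ≤ Real.pi / 2 := div_le_self (by positivity) hC1
  have hsub : Ioo 0 x₀ ⊆ Ioo 0 (Real.pi / 2) := Ioo_subset_Ioo_right hx₀'
  set U : Set ℝ := ⋃ x ∈ Ioo 0 x₀, {κ | C * x < φ κ x}
  set V : Set ℝ := ⋃ x ∈ Ioo 0 x₀, {κ | φ κ x < -(C * x)}
  have hU : IsOpen U := isOpen_biUnion fun x hx =>
    isOpen_lt continuous_const (angle_continuousAt_param hp hφ0 hφ (hsub hx))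
  have hV : IsOpen V := isOpen_biUnion fun x hx =>
    isOpen_lt (angle_continuousAt_param hp hφ0 hφ (hsub hx)) continuous_const
  -- Otherwise `U` and `V` would be open, meet `[κl, κu]` each, cover it, and be disjoint on it.
  obtain ⟨κ, hκ, hκn⟩ : ∃ κ ∈ Icc κl κu, κ ∉ U ∪ V := by
    by_contra! hcov
    obtain ⟨x, hx, hxl⟩ := hlow C x₀ hx₀ hCx₀.le hx₀' hC0
    obtain ⟨x', hx', hxu⟩ := exists_lt_neg_of_upper_param hp hN le_rfl (hφ0 κu) (hφ κu)
      hC1 hx₀ hx₀'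
    obtain ⟨κ, hκ, hκU, hκV⟩ := isPreconnected_Icc (a := κl) (b := κu) U V hU hV hcov
      ⟨κl, left_mem_Icc.2 hle, mem_biUnion hx hxl⟩
      ⟨κu, right_mem_Icc.2 hle, mem_biUnion hx' hxu⟩
    simp only [U, V, mem_iUnion] at hκU hκV
    obtain ⟨y, hy, hya⟩ := hκU
    obtain ⟨z, hz, hzb⟩ := hκV
    exact (not_above_and_below hp hN (hCκ κ hκ) hC0 hCx₀.le hx₀'
      (fun t ht => hφ κ t ⟨ht.1, by linarith [(hsub ht).2]⟩) hy hz hya).not_gt hzb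
  simp only [U, V, mem_union, mem_iUnion, not_or, not_exists, mem_ofPred_eq, not_lt] at hκn
  have hlin : ∀ x ∈ Ioo 0 x₀, |φ κ x| ≤ C * x := fun x hx =>
    abs_le.2 ⟨hκn.2 x hx, hκn.1 x hx⟩
  have h0 : Tendsto (φ κ) (𝓝[>] 0) (𝓝 0) := tendsto_zero_of_abs_le hx₀ hlin
  exact ⟨κ, φ κ, hposκ κ hκ.1 h0, lt_of_angle_solution hp hN
    (fun t ht => hφ κ t ⟨ht.1, by linarith [ht.2]⟩)
    (angle_tendsto_pi_div_two (hφ0 κ) (hφ κ)) h0, hφ κ, hφ0 κ, C, x₀, hx₀, hlin⟩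


/-! ### Behaviour of the solution of the shooting problem -/

lemma angle_pos (hp : 1 < p) (hN : 2 < N) (hκ : N - p < κ * (p - 1)) {φ : ℝ → ℝ}
    (hφ : ∀ t ∈ Ioo 0 (Real.pi / 2), HasDerivAt φ (angleField p N κ t (φ t)) t)
    (h0 : Tendsto φ (𝓝[>] 0) (𝓝 0)) : ∀ x ∈ Ioo 0 (Real.pi / 2), 0 < φ x :=
  (angle_comparison (κ := κ) hp hN (v := fun _ => 0) (v' := fun _ => 0)
    (c := κ * (p - 1) + p - N) (by linarith) hφ (fun x _ => hasDerivAt_const x 0)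
    h0 tendsto_const_nhds (fun x _ => by rw [angleField_zero]; linarith)).1

lemma angle_lt_pi_div_two (hp : 1 < p) (hκ : 0 < κ) {φ : ℝ → ℝ}
    (hφ0 : φ (Real.pi / 2) = Real.pi / 2)
    (hφ : ∀ t ∈ Ioo 0 Real.pi, HasDerivAt φ (angleField p N κ t (φ t)) t) :
    ∀ x ∈ Ioo 0 (Real.pi / 2), φ x < Real.pi / 2 := by
  intro x hx
  have hpi := Real.pi_pos
  by_contra! hle
  have := pos_of_deriv_pos_at_zeros (v := fun x => φ x - Real.pi / 2) (y := Real.pi / 2)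
    (fun x hx => (hφ x hx).sub_const _) (fun x hx hz => by
      rw [sub_eq_zero] at hz
      rwa [hz, angleField_pi_div_two hp])
    ⟨hx.1, by linarith [hx.2]⟩ ⟨by linarith, by linarith⟩ hx.2 (by simpa using hle)
  rw [hφ0] at this
  linarith

/-! ### Slope at the singular endpoint and monotonicity of the angle -/

lemma continuous_angleDen : Continuous (angleDen p) := by unfold angleDen; fun_prop

lemma hasDerivAt_sin_mul_cos_div_angleDen :
    HasDerivAt (fun θ => Real.sin θ * Real.cos θ / angleDen p θ) 1 0 := by
  have h1 : HasDerivAt (fun θ => Real.sin θ * Real.cos θ) 1 0 :=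
    ((Real.hasDerivAt_sin 0).mul (Real.hasDerivAt_cos 0)).congr_deriv (by simp)
  have h2 : HasDerivAt (angleDen p) 0 0 :=
    (((Real.hasDerivAt_cos 0).pow 2).add
      (((Real.hasDerivAt_sin 0).pow 2).const_mul (p - 1))).congr_deriv (by simp)
  exact (h1.div h2 (by simp [angleDen])).congr_deriv (by simp [angleDen])

/-- The slope at `0` of a solution of the angle equation that is `O(x)`. -/
lemma angleField_tendsto_slope (hp : 1 < p) (hN : 2 < N) {φ : ℝ → ℝ} {C x₀ : ℝ} (hx₀ : 0 < x₀)
    (hφ : ∀ t ∈ Ioo 0 (Real.pi / 2), HasDerivAt φ (angleField p N κ t (φ t)) t)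
    (hlin : ∀ x ∈ Ioo 0 x₀, |φ x| ≤ C * x) :
    Tendsto (fun x => angleField p N κ x (φ x)) (𝓝[>] 0)
      (𝓝 ((κ * (p - 1) + p - N) / (N - 1))) := by
  have hpi := Real.pi_pos
  have h0 : Tendsto φ (𝓝[>] 0) (𝓝 0) := tendsto_zero_of_abs_le hx₀ hlin
  set g : ℝ → ℝ := fun θ => Real.sin θ * Real.cos θ / angleDen p θ
  set R : ℝ → ℝ := fun θ => (κ * (p - 1) + (p - N) * Real.cos θ ^ 2) / angleDen p θ
  set R₀ := κ * (p - 1) + p - N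
  have hField : ∀ x θ, angleField p N κ x θ = R θ - (N - 2) * Real.cot x * g θ := by
    intro x θ
    simp only [angleField, R, g]
    ring
  have hIoo : Ioo 0 (Real.pi / 2) ∈ 𝓝[>] (0 : ℝ) := Ioo_mem_nhdsGT (by linarith)
  have hRlim : Tendsto (fun x => R (φ x)) (𝓝[>] 0) (𝓝 R₀) := by
    have hc : ContinuousAt R 0 := by
      refine ContinuousAt.div (by fun_prop) continuous_angleDen.continuousAt
        (angleDen_pos hp 0).ne'
    have : R 0 = R₀ := by simp [R, R₀, angleDen]; ring
    rw [← this]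
    exact Tendsto.comp hc h0
  -- Since `g θ = θ + o(θ)` and `φ = O(x)`, linearising the singular term costs only `o(1)`.
  have hrem : Tendsto (fun x => Real.cot x * (φ x - g (φ x))) (𝓝[>] 0) (𝓝 0) := by
    have ho : (fun x => φ x - g (φ x)) =o[𝓝[>] 0] fun x => x := by
      have h1 : (fun θ => g θ - θ) =o[𝓝 0] fun θ => θ := by
        have := hasDerivAt_iff_isLittleO.1 (hasDerivAt_sin_mul_cos_div_angleDen (p := p))
        simpa [g] using this
      have h2 : φ =O[𝓝[>] 0] fun x => x := by
        refine Asymptotics.IsBigO.of_bound C ?_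
        filter_upwards [Ioo_mem_nhdsGT hx₀] with x hx
        rw [Real.norm_eq_abs, Real.norm_eq_abs, abs_of_pos hx.1]
        exact hlin x hx
      have h3 := (h1.comp_tendsto h0).trans_isBigO h2
      refine h3.neg_left.congr_left fun x => ?_
      simp
    refine squeeze_zero_norm' ?_ (tendsto_zero_iff_norm_tendsto_zero.1 ho.tendsto_div_nhds_zero)
    filter_upwards [hIoo] with x hx
    rw [norm_mul, norm_div, div_eq_inv_mul, Real.norm_eq_abs (Real.cot x),
      abs_of_nonneg (cot_nonneg_of_mem hx), Real.norm_of_nonneg hx.1.le]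
    gcongr
    exact cot_le_inv hx
  have hN1 : 0 < N - 1 := by linarith
  have hnum : Tendsto (fun x => angleField p N κ x (φ x) + (N - 2) * Real.cot x * φ x)
      (𝓝[>] 0) (𝓝 R₀) := by
    have := hRlim.add (hrem.const_mul (N - 2))
    rw [mul_zero, add_zero] at this
    refine this.congr fun x => ?_
    rw [hField]
    ring
  have hsin0 : Tendsto Real.sin (𝓝[>] 0) (𝓝 0) := by
    have := Real.continuous_sin.tendsto 0
    rw [Real.sin_zero] at this
    exact this.mono_left nhdsWithin_le_nhds
  have hcos0 : Tendsto Real.cos (𝓝[>] 0) (𝓝 1) := by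
    have := Real.continuous_cos.tendsto 0
    rw [Real.cos_zero] at this
    exact this.mono_left nhdsWithin_le_nhds
  have hrpow0 : ∀ n : ℝ, 0 < n → Tendsto (fun x => Real.sin x ^ n) (𝓝[>] 0) (𝓝 0) := by
    intro n hn
    have := hsin0.rpow_const (p := n) (Or.inr hn.le)
    rwa [Real.zero_rpow hn.ne'] at this
  have hsinpos : ∀ x ∈ Ioo 0 (Real.pi / 2), 0 < Real.sin x := fun x hx =>
    Real.sin_pos_of_mem_Ioo ⟨hx.1, by linarith [hx.2]⟩
  have hcospos : ∀ x ∈ Ioo 0 (Real.pi / 2), 0 < Real.cos x := fun x hx =>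
    Real.cos_pos_of_mem_Ioo ⟨by linarith [hx.1], hx.2⟩
  -- `sin ^ (N - 2)` is the integrating factor of `φ' + (N - 2) cot x φ`, which tends to `R₀`;
  -- L'Hôpital then gives the limit of `φ / sin x`.
  have hquot : Tendsto (fun x => φ x * Real.sin x ^ (N - 2) / Real.sin x ^ (N - 1)) (𝓝[>] 0)
      (𝓝 (R₀ / (N - 1))) := by
    refine HasDerivAt.lhopital_zero_right_on_Ioo (a := 0) (b := Real.pi / 2) (by linarith)
      (f' := fun x => Real.sin x ^ (N - 2) *
        (angleField p N κ x (φ x) + (N - 2) * Real.cot x * φ x))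
      (g' := fun x => (N - 1) * Real.sin x ^ (N - 2) * Real.cos x)
      (fun x hx => ?_) (fun x hx => ?_) (fun x hx => ?_) ?_ (hrpow0 _ hN1) ?_
    · have hs := hsinpos x hx
      refine ((hφ x hx).mul ((Real.hasDerivAt_sin x).rpow_const (p := N - 2)
        (Or.inl hs.ne'))).congr_deriv ?_
      rw [Real.rpow_sub_one hs.ne', Real.cot_eq_cos_div_sin]
      ring
    · have hs := hsinpos x hx
      refine ((Real.hasDerivAt_sin x).rpow_const (p := N - 1) (Or.inl hs.ne')).congr_deriv ?_
      rw [show N - 1 - 1 = N - 2 by ring]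
      ring
    · have := Real.rpow_pos_of_pos (hsinpos x hx) (N - 2)
      have := hcospos x hx
      positivity
    · simpa using h0.mul (hrpow0 _ (by linarith : 0 < N - 2))
    · have := hnum.div (hcos0.const_mul (N - 1)) (by simpa using hN1.ne')
      rw [mul_one] at this
      refine this.congr' ?_
      filter_upwards [hIoo] with x hx
      have := (Real.rpow_pos_of_pos (hsinpos x hx) (N - 2)).ne'
      have := (hcospos x hx).ne'
      simp only [Pi.div_apply]
      field_simp
  have hcot : Tendsto (fun x => Real.cot x * φ x) (𝓝[>] 0) (𝓝 (R₀ / (N - 1))) := by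
    have := hcos0.mul hquot
    rw [one_mul] at this
    refine this.congr' ?_
    filter_upwards [hIoo] with x hx
    have hs := hsinpos x hx
    have := (Real.rpow_pos_of_pos hs (N - 2)).ne'
    rw [show N - 1 = (N - 2) + 1 by ring, Real.rpow_add_one hs.ne', Real.cot_eq_cos_div_sin]
    field_simp
  have := hnum.sub (hcot.const_mul (N - 2))
  have hval : R₀ - (N - 2) * (R₀ / (N - 1)) = R₀ / (N - 1) := by field_simp; ring
  rw [hval] at this
  refine this.congr fun x => ?_
  ring

lemma hasDerivAt_cot {x : ℝ} (hx : Real.sin x ≠ 0) :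
    HasDerivAt Real.cot (-(1 / Real.sin x ^ 2)) x := by
  have h1 : Real.cot = fun x => Real.cos x / Real.sin x := funext Real.cot_eq_cos_div_sin
  rw [h1]
  refine ((Real.hasDerivAt_cos x).div (Real.hasDerivAt_sin x) hx).congr_deriv ?_
  rw [← neg_div]
  congr 1
  linarith [Real.sin_sq_add_cos_sq x]

/-- The angle is strictly increasing. -/
lemma angleField_pos (hp : 1 < p) (hN : 2 < N) {φ : ℝ → ℝ} {a : ℝ} (ha : 0 < a)
    (hφ : ∀ t ∈ Ioo 0 (Real.pi / 2), HasDerivAt φ (angleField p N κ t (φ t)) t)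
    (hmem : ∀ t ∈ Ioo 0 (Real.pi / 2), φ t ∈ Ioo 0 (Real.pi / 2))
    (hlim : Tendsto (fun x => angleField p N κ x (φ x)) (𝓝[>] 0) (𝓝 a)) :
    ∀ x ∈ Ioo 0 (Real.pi / 2), 0 < angleField p N κ x (φ x) := by
  intro x hx
  set G : ℝ → ℝ := fun x => κ * (p - 1) + (p - N) * Real.cos (φ x) ^ 2
    - (N - 2) * (Real.sin (φ x) * Real.cos (φ x)) * Real.cot x with hG
  have hFG : ∀ x, angleField p N κ x (φ x) = G x / angleDen p (φ x) := fun x => rfl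
  obtain ⟨y, hy, hy1⟩ := ((hlim.eventually_const_lt ha).and
    (Ioo_mem_nhdsGT hx.1)).exists
  have hy' : y ∈ Ioo 0 (Real.pi / 2) := ⟨hy1.1, hy1.2.trans hx.2⟩
  have hGy : 0 ≤ G y := by
    rw [hFG] at hy
    exact ((div_pos_iff_of_pos_right (angleDen_pos hp _)).1 hy).le
  rw [hFG]
  refine div_pos ?_ (angleDen_pos hp _)
  -- At a zero of the numerator `G` also `φ' = 0`, so only the derivative of `cot` contributes to
  -- `G'`, and its contribution is positive.
  refine pos_of_deriv_pos_at_zeros (v := G) (v' := fun x =>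
    ((p - N) * (2 * Real.cos (φ x) * -Real.sin (φ x))
      - (N - 2) * (Real.cos (φ x) * Real.cos (φ x) - Real.sin (φ x) * Real.sin (φ x))
        * Real.cot x) * angleField p N κ x (φ x)
      + (N - 2) * (Real.sin (φ x) * Real.cos (φ x)) * (1 / Real.sin x ^ 2))
    (fun z hz => ?_) (fun z hz hz0 => ?_) hy' hx hy1.2 hGy
  · have hs : Real.sin z ≠ 0 :=
      (Real.sin_pos_of_mem_Ioo ⟨hz.1, by linarith [hz.2, Real.pi_pos]⟩).ne'
    have hsin := (hφ z hz).sin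
    have hcos := (hφ z hz).cos
    have h1 := ((hcos.pow 2).const_mul (p - N)).const_add (κ * (p - 1))
    have h2 := ((hsin.mul hcos).const_mul (N - 2)).mul (hasDerivAt_cot hs)
    refine (h1.sub h2).congr_deriv ?_
    simp only [Nat.cast_ofNat, Pi.mul_apply]
    ring
  · rw [hFG, hz0, zero_div, mul_zero, zero_add]
    have hs : 0 < Real.sin z :=
      Real.sin_pos_of_mem_Ioo ⟨hz.1, by linarith [hz.2, Real.pi_pos]⟩
    have h1 : 0 < Real.sin (φ z) := Real.sin_pos_of_mem_Ioo
      ⟨(hmem z hz).1, by linarith [(hmem z hz).2, Real.pi_pos]⟩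
    have h2 : 0 < Real.cos (φ z) := Real.cos_pos_of_mem_Ioo
      ⟨by linarith [(hmem z hz).1, Real.pi_pos], (hmem z hz).2⟩
    have : 0 < N - 2 := by linarith
    positivity

/-- The limit of the derivative at `0` is the one-sided derivative there. -/
lemma contDiffOn_one_Ico {f f' : ℝ → ℝ} {a b : ℝ} (hb : 0 < b)
    (hf : ∀ x ∈ Ioo 0 b, HasDerivAt f (f' x) x) (hf' : ContinuousOn f' (Ioo 0 b))
    (h0 : Tendsto f (𝓝[>] 0) (𝓝 (f 0))) (h0' : Tendsto f' (𝓝[>] 0) (𝓝 a)) :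
    ContDiffOn ℝ 1 f (Ico 0 b) := by
  have hIoo : Ioo 0 b ∈ 𝓝[>] (0 : ℝ) := Ioo_mem_nhdsGT hb
  have hcont : ContinuousWithinAt f (Ioo 0 b) 0 :=
    h0.mono_left (nhdsWithin_mono _ Ioo_subset_Ioi_self)
  have hd0 : HasDerivWithinAt f a (Ico 0 b) 0 := by
    refine (hasDerivWithinAt_Ici_of_tendsto_deriv
      (fun x hx => (hf x hx).differentiableAt.differentiableWithinAt) hcont hIoo ?_).mono
      Ico_subset_Ici_self
    refine h0'.congr' ?_
    filter_upwards [hIoo] with x hx using (hf x hx).deriv.symm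
  have huniq := uniqueDiffOn_Ico (0 : ℝ) b
  have hmem0 : (0 : ℝ) ∈ Ico 0 b := ⟨le_rfl, hb⟩
  have hval : ∀ x ∈ Ioo 0 b, derivWithin f (Ico 0 b) x = f' x := fun x hx =>
    (hf x hx).hasDerivWithinAt.derivWithin (huniq x (Ioo_subset_Ico_self hx))
  rw [contDiffOn_one_iff_derivWithin huniq]
  constructor
  · intro x hx
    rcases hx.1.eq_or_lt with h | h
    · rw [← h]; exact hd0.differentiableWithinAt
    · exact (hf x ⟨h, hx.2⟩).differentiableAt.differentiableWithinAt
  · intro x hx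
    rcases hx.1.eq_or_lt with h | h
    · rw [← h]
      have hlim : Tendsto (derivWithin f (Ico 0 b)) (𝓝[>] 0)
          (𝓝 (derivWithin f (Ico 0 b) 0)) := by
        rw [hd0.derivWithin (huniq 0 hmem0)]
        refine h0'.congr' ?_
        filter_upwards [hIoo] with x hx using (hval x hx).symm
      have : ContinuousWithinAt (derivWithin f (Ico 0 b)) (Ici 0) 0 :=
        continuousWithinAt_Ioi_iff_Ici.1 hlim
      exact this.mono Ico_subset_Ici_self
    · have hx' : x ∈ Ioo 0 b := ⟨h, hx.2⟩
      have hnhds := Ioo_mem_nhds hx'.1 hx'.2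
      refine ((hf'.continuousAt hnhds).congr ?_).continuousWithinAt
      filter_upwards [hnhds] with y hy using (hval y hy).symm

theorem exists_angle_profile (hp : 1 < p) (hN : 2 < N) :
    ∃ κ, ∃ φ : ℝ → ℝ, 0 < κ ∧ N - p < κ * (p - 1) ∧
      (∀ t ∈ Ioo 0 (Real.pi / 2), HasDerivAt φ (angleField p N κ t (φ t)) t) ∧
      (∀ t ∈ Ioo 0 (Real.pi / 2), φ t ∈ Ioo 0 (Real.pi / 2)) ∧
      (∀ t ∈ Ioo 0 (Real.pi / 2), 0 < angleField p N κ t (φ t)) ∧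
      φ 0 = 0 ∧ ContDiffOn ℝ 1 φ (Ico 0 (Real.pi / 2)) ∧
      Tendsto φ (𝓝[<] (Real.pi / 2)) (𝓝 (Real.pi / 2)) := by
  have hpi := Real.pi_pos
  obtain ⟨κ, φ, hκ, hκ', hφ, hφ1, C, x₀, hx₀, hlin⟩ := exists_angle_solution hp hN
  have hsub : Ioo 0 (Real.pi / 2) ⊆ Ioo 0 Real.pi := Ioo_subset_Ioo_right (by linarith)
  have hφ' := fun t ht => hφ t (hsub ht)
  have h0 : Tendsto φ (𝓝[>] 0) (𝓝 0) := tendsto_zero_of_abs_le hx₀ hlin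
  have hmem : ∀ t ∈ Ioo 0 (Real.pi / 2), φ t ∈ Ioo 0 (Real.pi / 2) := fun t ht =>
    ⟨angle_pos hp hN hκ' hφ' h0 t ht, angle_lt_pi_div_two hp hκ hφ1 hφ t ht⟩
  have hslope := angleField_tendsto_slope hp hN hx₀ hφ' hlin
  have hpos := angleField_pos hp hN (div_pos (by linarith) (by linarith)) hφ' hmem hslope
  have hcont : ContinuousOn (fun x => angleField p N κ x (φ x)) (Ioo 0 (Real.pi / 2)) := by
    have h1 : ContinuousOn φ (Ioo 0 (Real.pi / 2)) :=
      fun x hx => (hφ' x hx).continuousAt.continuousWithinAt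
    have h2 := continuousOn_cot.mono hsub
    unfold angleField
    refine ContinuousOn.div ?_ (continuous_angleDen.comp_continuousOn h1)
      fun x _ => (angleDen_pos hp _).ne'
    fun_prop
  -- The shooting problem does not control the value at `0`; it is replaced by the limit.
  set ψ : ℝ → ℝ := Function.update φ 0 0
  have hψ : ∀ x, 0 < x → ψ x = φ x := fun x hx => Function.update_of_ne hx.ne' _ _
  have hψ0 : ψ 0 = 0 := Function.update_self _ _ _
  have hψd : ∀ t ∈ Ioo 0 (Real.pi / 2), HasDerivAt ψ (angleField p N κ t (φ t)) t := by
    intro t ht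
    refine (hφ' t ht).congr_of_eventuallyEq ?_
    filter_upwards [Ioi_mem_nhds ht.1] with x hx using hψ x hx
  refine ⟨κ, ψ, hκ, hκ', fun t ht => ?_, fun t ht => ?_, fun t ht => ?_, hψ0,
    contDiffOn_one_Ico (by linarith) hψd hcont ?_ hslope, ?_⟩
  · rw [hψ t ht.1]; exact hψd t ht
  · rw [hψ t ht.1]; exact hmem t ht
  · rw [hψ t ht.1]; exact hpos t ht
  · rw [hψ0]
    refine h0.congr' ?_
    filter_upwards [self_mem_nhdsWithin] with x hx using (hψ x hx).symm
  · refine (angle_tendsto_pi_div_two hφ1 hφ).congr' ?_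
    filter_upwards [Ioo_mem_nhdsLT (by linarith : (0 : ℝ) < Real.pi / 2)] with x hx
    exact (hψ x hx.1).symm


/-! ### From the angle to the Riccati equation and back -/

lemma angleField_eq_tan (x : ℝ) {θ κ : ℝ} (hθ : Real.cos θ ≠ 0) :
    angleField p N κ x θ = (κ * (p - 1) * (1 + Real.tan θ ^ 2) + (p - N)
      - (N - 2) * Real.tan θ * Real.cot x) / (1 + (p - 1) * Real.tan θ ^ 2) := by
  unfold angleField angleDen
  rw [Real.tan_eq_sin_div_cos]
  have h1 : Real.cos θ ^ 2 + (p - 1) * Real.sin θ ^ 2 =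
      Real.cos θ ^ 2 * (1 + (p - 1) * (Real.sin θ / Real.cos θ) ^ 2) := by field_simp
  have h2 : κ * (p - 1) + (p - N) * Real.cos θ ^ 2
      - (N - 2) * (Real.sin θ * Real.cos θ) * Real.cot x =
      Real.cos θ ^ 2 * (κ * (p - 1) * (1 + (Real.sin θ / Real.cos θ) ^ 2) + (p - N)
      - (N - 2) * (Real.sin θ / Real.cos θ) * Real.cot x) := by
    have h3 : Real.cos θ ^ 2 * (1 + (Real.sin θ / Real.cos θ) ^ 2) = 1 := by
      field_simp
      exact Real.cos_sq_add_sin_sq θ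
    have h4 : Real.cos θ ^ 2 * (Real.sin θ / Real.cos θ) = Real.sin θ * Real.cos θ := by
      field_simp
    linear_combination (-(κ * (p - 1))) * h3 + (N - 2) * Real.cot x * h4
  rw [h1, h2, mul_div_mul_left _ _ (pow_ne_zero 2 hθ)]

/-- After division by `k³` the terms carrying `k` combine to `-k (p - 1) (1 + T ^ 2) ^ 2`, so `1 + T
^ 2` factors out. It is the factor that `T = tan φ` absorbs. -/
lemma riccati_iff (hp : 1 < p) (hk : k ≠ 0) (T T' c : ℝ) :
    ((p - 1) * (k * T) ^ 2 + k ^ 2) * (k * T' + (k * T) ^ 2) =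
      ((3 - 2 * p) * k + p - N) * k * (k * T) ^ 2 + (k * (1 - p) + p - N) * k ^ 3
        + (2 - N) * (k * T) * c * ((k * T) ^ 2 + k ^ 2) ↔
    T' = (1 + T ^ 2) * ((-k * (p - 1) * (1 + T ^ 2) + (p - N) - (N - 2) * T * c)
      / (1 + (p - 1) * T ^ 2)) := by
  have hp1 : 0 < p - 1 := by linarith
  have hD : 0 < 1 + (p - 1) * T ^ 2 := by positivity
  rw [← mul_div_assoc, eq_div_iff hD.ne']
  constructor
  · intro h
    refine mul_left_cancel₀ (pow_ne_zero 3 hk) ?_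
    linear_combination h
  · intro h
    linear_combination k ^ 3 * h

/-- If `H` satisfies the Riccati equation, then `arctan (H / k)` satisfies the angle equation. -/
lemma hasDerivAt_arctan_of_riccati (hp : 1 < p) (hk : k ≠ 0) {H : ℝ → ℝ} {H' x : ℝ}
    (hH : HasDerivAt H H' x)
    (heq : ((p - 1) * (H x) ^ 2 + k ^ 2) * (H' + (H x) ^ 2) =
      ((3 - 2 * p) * k + p - N) * k * (H x) ^ 2 + (k * (1 - p) + p - N) * k ^ 3
        + (2 - N) * H x * Real.cot x * ((H x) ^ 2 + k ^ 2)) :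
    HasDerivAt (fun x => Real.arctan (H x / k))
      (angleField p N (-k) x (Real.arctan (H x / k))) x := by
  have h1 : k * (H x / k) = H x := mul_div_cancel₀ _ hk
  have h2 : k * (H' / k) = H' := mul_div_cancel₀ _ hk
  have h := (riccati_iff (N := N) hp hk (H x / k) (H' / k) (Real.cot x)).1 (by rwa [h1, h2])
  refine (hH.div_const k).arctan.congr_deriv ?_
  have hpos : 0 < 1 + (H x / k) ^ 2 := by positivity
  rw [angleField_eq_tan _ (Real.cos_arctan_pos _).ne', Real.tan_arctan, h, ← mul_assoc,
    one_div, inv_mul_cancel₀ hpos.ne', one_mul]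

lemma riccati_of_angle (hp : 1 < p) (hk : k ≠ 0) {φ : ℝ → ℝ} {x : ℝ}
    (hφ : HasDerivAt φ (angleField p N (-k) x (φ x)) x) (hcos : Real.cos (φ x) ≠ 0) :
    ∃ H', HasDerivAt (fun x => k * Real.tan (φ x)) H' x ∧
      H' = k * ((1 + Real.tan (φ x) ^ 2) * angleField p N (-k) x (φ x)) ∧
      ((p - 1) * (k * Real.tan (φ x)) ^ 2 + k ^ 2) * (H' + (k * Real.tan (φ x)) ^ 2) =
      ((3 - 2 * p) * k + p - N) * k * (k * Real.tan (φ x)) ^ 2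
        + (k * (1 - p) + p - N) * k ^ 3
        + (2 - N) * (k * Real.tan (φ x)) * Real.cot x * ((k * Real.tan (φ x)) ^ 2 + k ^ 2) := by
  have hd : HasDerivAt (fun x => Real.tan (φ x))
      ((1 + Real.tan (φ x) ^ 2) * angleField p N (-k) x (φ x)) x := by
    refine ((Real.hasDerivAt_tan hcos).comp x hφ).congr_deriv ?_
    have : 1 + Real.tan (φ x) ^ 2 = 1 / Real.cos (φ x) ^ 2 := by
      rw [Real.tan_eq_sin_div_cos]
      field_simp
      exact Real.cos_sq_add_sin_sq _
    rw [this]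
  refine ⟨_, hd.const_mul k, rfl, ?_⟩
  rw [riccati_iff hp hk, angleField_eq_tan _ hcos]

/-- The logarithmic derivative of a solution `y` satisfies the Riccati equation. -/
lemma riccati_of_linear {y y' y'' c : ℝ} (hy : y ≠ 0)
    (h : ((p - 1) * y' ^ 2 + k ^ 2 * y ^ 2) * y'' =
      ((3 - 2 * p) * k + p - N) * k * y * y' ^ 2 + (k * (1 - p) + p - N) * k ^ 3 * y ^ 3
        + (2 - N) * y' * c * (y' ^ 2 + k ^ 2 * y ^ 2)) :
    ((p - 1) * (y' / y) ^ 2 + k ^ 2) * ((y'' * y - y' * y') / y ^ 2 + (y' / y) ^ 2) =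
      ((3 - 2 * p) * k + p - N) * k * (y' / y) ^ 2 + (k * (1 - p) + p - N) * k ^ 3
        + (2 - N) * (y' / y) * c * ((y' / y) ^ 2 + k ^ 2) := by
  field_simp
  linear_combination y * h

/-! ### Regularity of solutions up to the left endpoint -/

lemma IsRiccatiSolution.hasDerivAt {H : ℝ → ℝ} (h : IsRiccatiSolution p N k H) {x : ℝ}
    (hx : x ∈ Ioo 0 (Real.pi / 2)) : HasDerivAt H (deriv H x) x :=
  (((h.contDiffOn.differentiableOn one_ne_zero) x (Ioo_subset_Ico_self hx)).differentiableAt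
    (Ico_mem_nhds hx.1 hx.2)).hasDerivAt

lemma tendsto_nhdsGT_of_continuousOn_Ico {f : ℝ → ℝ} {b : ℝ} (hb : 0 < b)
    (hf : ContinuousOn f (Ico 0 b)) : Tendsto f (𝓝[>] 0) (𝓝 (f 0)) := by
  have h1 : Tendsto f (𝓝[Ico 0 b] 0) (𝓝 (f 0)) := hf 0 ⟨le_rfl, hb⟩
  rw [nhdsWithin_Ico_eq_nhdsGE hb] at h1
  exact h1.mono_left (nhdsWithin_mono _ Ioi_subset_Ici_self)

lemma IsRiccatiSolution.angle (hp : 1 < p) (hk : k ≠ 0) {H : ℝ → ℝ}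
    (h : IsRiccatiSolution p N k H) :
    (∀ x ∈ Ioo 0 (Real.pi / 2), HasDerivAt (fun x => Real.arctan (H x / k))
      (angleField p N (-k) x (Real.arctan (H x / k))) x) ∧
    Tendsto (fun x => Real.arctan (H x / k)) (𝓝[>] 0) (𝓝 0) := by
  refine ⟨fun x hx => hasDerivAt_arctan_of_riccati hp hk (h.hasDerivAt hx) (h.eqn x hx), ?_⟩
  have h1 := tendsto_nhdsGT_of_continuousOn_Ico (by linarith [Real.pi_pos])
    h.contDiffOn.continuousOn
  rw [h.init] at h1
  have := (Real.continuous_arctan.tendsto _).comp (h1.div_const k)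
  simpa [Function.comp_def] using this

lemma IsSolution.continuousOn {y : ℝ → ℝ} (h : IsSolution p N k y) :
    ContinuousOn y (Ico 0 (Real.pi / 2)) := h.contDiffOn.continuousOn

lemma IsSolution.hasDerivAt {y : ℝ → ℝ} (h : IsSolution p N k y) {x : ℝ}
    (hx : x ∈ Ioo 0 (Real.pi / 2)) : HasDerivAt y (deriv y x) x :=
  (((h.contDiffOn.differentiableOn two_ne_zero) x (Ioo_subset_Ico_self hx)).differentiableAt
    (Ico_mem_nhds hx.1 hx.2)).hasDerivAt

lemma IsSolution.hasDerivAt_deriv {y : ℝ → ℝ} (h : IsSolution p N k y) {x : ℝ}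
    (hx : x ∈ Ioo 0 (Real.pi / 2)) : HasDerivAt (deriv y) (deriv (deriv y) x) x := by
  have h1 : ContDiffOn ℝ (1 + 1) y (Ioo 0 (Real.pi / 2)) := by
    rw [one_add_one_eq_two]
    exact h.contDiffOn.mono Ioo_subset_Ico_self
  have h2 := ((contDiffOn_succ_iff_deriv_of_isOpen isOpen_Ioo).1 h1).2.2
  exact ((h2.differentiableOn one_ne_zero x hx).differentiableAt
    (Ioo_mem_nhds hx.1 hx.2)).hasDerivAt

lemma IsSolution.tendsto_deriv {y : ℝ → ℝ} (h : IsSolution p N k y) :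
    Tendsto (deriv y) (𝓝[>] 0) (𝓝 0) := by
  have hpi : 0 < Real.pi / 2 := by linarith [Real.pi_pos]
  have hc : ContinuousOn (derivWithin y (Ico 0 (Real.pi / 2))) (Ico 0 (Real.pi / 2)) :=
    h.contDiffOn.continuousOn_derivWithin (uniqueDiffOn_Ico _ _) (by norm_num)
  have h1 := tendsto_nhdsGT_of_continuousOn_Ico hpi hc
  rw [h.init_deriv] at h1
  refine h1.congr' ?_
  filter_upwards [Ioo_mem_nhdsGT hpi] with x hx
  exact derivWithin_of_mem_nhds (Ico_mem_nhds hx.1 hx.2)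

lemma IsSolution.angle (hp : 1 < p) (hk : k ≠ 0) {y : ℝ → ℝ} (h : IsSolution p N k y)
    {b : ℝ} (hb : b ≤ Real.pi / 2) (hpos : ∀ x ∈ Ioo 0 b, 0 < y x) :
    (∀ x ∈ Ioo 0 b, HasDerivAt (fun x => Real.arctan (deriv y x / y x / k))
      (angleField p N (-k) x (Real.arctan (deriv y x / y x / k))) x) ∧
    Tendsto (fun x => Real.arctan (deriv y x / y x / k)) (𝓝[>] 0) (𝓝 0) := by
  constructor
  · intro x hx
    have hx' : x ∈ Ioo 0 (Real.pi / 2) := ⟨hx.1, hx.2.trans_le hb⟩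
    have hy := (hpos x hx).ne'
    exact hasDerivAt_arctan_of_riccati (H := fun x => deriv y x / y x) hp hk
      ((h.hasDerivAt_deriv hx').div (h.hasDerivAt hx') hy) (riccati_of_linear hy (h.eqn x hx'))
  · have h1 := tendsto_nhdsGT_of_continuousOn_Ico (by linarith [Real.pi_pos]) h.continuousOn
    rw [h.init] at h1
    have := (Real.continuous_arctan.tendsto _).comp
      ((h.tendsto_deriv.div h1 one_ne_zero).div_const k)
    simpa [Function.comp_def] using this

/-! ### Construction of the solutions from the angle -/

lemma exists_pos_of_logDeriv {H : ℝ → ℝ} {b : ℝ} (hb : 0 < b) (hH : ContinuousOn H (Ico 0 b)) :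
    ∃ y : ℝ → ℝ, y 0 = 1 ∧ (∀ x, 0 < y x) ∧ ∀ x ∈ Ico 0 b, HasDerivAt y (H x * y x) x := by
  -- Constant extension to the left, so that `exp ∫ g` has a two-sided derivative at `0`.
  set g : ℝ → ℝ := fun x => H (max x 0)
  have hg : ContinuousOn g (Iio b) :=
    hH.comp (by fun_prop) fun x hx => ⟨le_max_right _ _, max_lt hx hb⟩
  refine ⟨fun x => Real.exp (∫ t in (0 : ℝ)..x, g t), by simp, fun x => Real.exp_pos _,
    fun x hx => ?_⟩
  have hint : IntervalIntegrable g MeasureTheory.volume 0 x := by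
    refine ContinuousOn.intervalIntegrable (hg.mono ?_)
    rw [uIcc_of_le hx.1]
    exact fun t ht => ht.2.trans_lt hx.2
  have hgx : g x = H x := by simp only [g, max_eq_left hx.1]
  have hd := intervalIntegral.integral_hasDerivAt_right hint
    (hg.stronglyMeasurableAtFilter isOpen_Iio x hx.2)
    (hg.continuousAt (Iio_mem_nhds hx.2))
  refine hd.exp.congr_deriv ?_
  rw [hgx, mul_comm]

lemma contDiffOn_two_of_logDeriv {H y : ℝ → ℝ} {b : ℝ} (hH : ContDiffOn ℝ 1 H (Ico 0 b))
    (hy : ∀ x ∈ Ico 0 b, HasDerivAt y (H x * y x) x) : ContDiffOn ℝ 2 y (Ico 0 b) := by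
  have huniq := uniqueDiffOn_Ico (0 : ℝ) b
  have hdiff : DifferentiableOn ℝ y (Ico 0 b) := fun x hx =>
    (hy x hx).differentiableAt.differentiableWithinAt
  have hval : ∀ x ∈ Ico 0 b, derivWithin y (Ico 0 b) x = H x * y x := fun x hx =>
    (hy x hx).hasDerivWithinAt.derivWithin (huniq x hx)
  have h1 : ContDiffOn ℝ 1 y (Ico 0 b) := by
    rw [contDiffOn_one_iff_derivWithin huniq]
    exact ⟨hdiff, (hH.continuousOn.mul hdiff.continuousOn).congr hval⟩
  rw [← one_add_one_eq_two, contDiffOn_succ_iff_derivWithin huniq]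
  exact ⟨hdiff, by simp, (hH.mul h1).congr hval⟩

lemma isRiccatiSolution_tan (hp : 1 < p) (hk : k ≠ 0) {φ : ℝ → ℝ}
    (hφ : ∀ t ∈ Ioo 0 (Real.pi / 2), HasDerivAt φ (angleField p N (-k) t (φ t)) t)
    (hmem : ∀ t ∈ Ioo 0 (Real.pi / 2), φ t ∈ Ioo 0 (Real.pi / 2)) (h0 : φ 0 = 0)
    (hφC : ContDiffOn ℝ 1 φ (Ico 0 (Real.pi / 2))) :
    IsRiccatiSolution p N k fun x => k * Real.tan (φ x) := by
  have hcos : ∀ x ∈ Ico 0 (Real.pi / 2), Real.cos (φ x) ≠ 0 := by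
    intro x hx
    rcases hx.1.eq_or_lt with h | h
    · rw [← h, h0]; simp
    · have := hmem x ⟨h, hx.2⟩
      exact (Real.cos_pos_of_mem_Ioo ⟨by linarith [this.1, Real.pi_pos], this.2⟩).ne'
  refine ⟨fun x hx => ?_, by simp [h0], fun x hx => ?_⟩
  · exact contDiffWithinAt_const.mul
      ((Real.contDiffAt_tan.2 (hcos x hx)).comp_contDiffWithinAt x (hφC x hx))
  · obtain ⟨H', h1, -, h2⟩ := riccati_of_angle hp hk (hφ x hx) (hcos x (Ioo_subset_Ico_self hx))
    simp only [h1.deriv]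
    exact h2

lemma isRiccatiProfile_tan (hp : 1 < p) (hk : k < 0) {φ : ℝ → ℝ}
    (hφ : ∀ t ∈ Ioo 0 (Real.pi / 2), HasDerivAt φ (angleField p N (-k) t (φ t)) t)
    (hmem : ∀ t ∈ Ioo 0 (Real.pi / 2), φ t ∈ Ioo 0 (Real.pi / 2))
    (hpos : ∀ t ∈ Ioo 0 (Real.pi / 2), 0 < angleField p N (-k) t (φ t))
    (hend : Tendsto φ (𝓝[<] (Real.pi / 2)) (𝓝 (Real.pi / 2))) :
    IsRiccatiProfile fun x => k * Real.tan (φ x) := by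
  have hpi : 0 < Real.pi / 2 := by linarith [Real.pi_pos]
  refine ⟨fun x hx => ?_, fun x hx => ?_, ?_⟩
  · exact mul_neg_of_neg_of_pos hk (Real.tan_pos_of_pos_of_lt_pi_div_two (hmem x hx).1
      (hmem x hx).2)
  · have hcos := (Real.cos_pos_of_mem_Ioo
      ⟨by linarith [(hmem x hx).1, Real.pi_pos], (hmem x hx).2⟩).ne'
    obtain ⟨H', h1, h2, -⟩ := riccati_of_angle hp hk.ne (hφ x hx) hcos
    rw [h1.deriv, h2]
    exact mul_neg_of_neg_of_pos hk (mul_pos (by positivity) (hpos x hx))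
  · refine (Tendsto.const_mul_atTop_of_neg hk (Real.tendsto_tan_pi_div_two.comp ?_))
    refine tendsto_nhdsWithin_iff.2 ⟨hend, ?_⟩
    filter_upwards [Ioo_mem_nhdsLT hpi] with x hx using (hmem x hx).2

lemma isSolution_of_logDeriv {H y : ℝ → ℝ} (hH : IsRiccatiSolution p N k H) (hy0 : y 0 = 1)
    (hy : ∀ x ∈ Ico 0 (Real.pi / 2), HasDerivAt y (H x * y x) x) : IsSolution p N k y := by
  have hpi : 0 < Real.pi / 2 := by linarith [Real.pi_pos]
  have hmem0 : (0 : ℝ) ∈ Ico 0 (Real.pi / 2) := ⟨le_rfl, hpi⟩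
  refine ⟨contDiffOn_two_of_logDeriv hH.contDiffOn hy, hy0, ?_, fun x hx => ?_⟩
  · rw [(hy 0 hmem0).hasDerivWithinAt.derivWithin (uniqueDiffOn_Ico _ _ 0 hmem0), hH.init,
      zero_mul]
  · have hyx := hy x (Ioo_subset_Ico_self hx)
    have hdd : deriv (deriv y) x = (deriv H x + H x ^ 2) * y x := by
      have hev : deriv y =ᶠ[𝓝 x] fun z => H z * y z := by
        filter_upwards [Ioo_mem_nhds hx.1 hx.2] with z hz
        exact (hy z (Ioo_subset_Ico_self hz)).deriv
      rw [hev.deriv_eq]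
      exact (((hH.hasDerivAt hx).mul hyx).congr_deriv (by ring)).deriv
    rw [hdd, hyx.deriv]
    linear_combination (y x) ^ 3 * hH.eqn x hx

lemma isProfile_of_logDeriv (hp : 1 < p) (hN : 2 < N) (hk : k < 0) {φ y : ℝ → ℝ}
    (hφ : ∀ t ∈ Ioo 0 (Real.pi / 2), HasDerivAt φ (angleField p N (-k) t (φ t)) t)
    (hmem : ∀ t ∈ Ioo 0 (Real.pi / 2), φ t ∈ Ioo 0 (Real.pi / 2)) (h0 : φ 0 = 0)
    (hφC : ContDiffOn ℝ 1 φ (Ico 0 (Real.pi / 2)))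
    (hend : Tendsto φ (𝓝[<] (Real.pi / 2)) (𝓝 (Real.pi / 2))) (hy0 : y 0 = 1)
    (hypos : ∀ x, 0 < y x)
    (hy : ∀ x ∈ Ico 0 (Real.pi / 2), HasDerivAt y (k * Real.tan (φ x) * y x) x) :
    IsProfile y := by
  have hpi : 0 < Real.pi / 2 := by linarith [Real.pi_pos]
  have hp1 : 0 < p - 1 := by linarith
  have hm := min_one_sub_pos hp
  have hmem0 : (0 : ℝ) ∈ Ico 0 (Real.pi / 2) := ⟨le_rfl, hpi⟩
  have htan : ∀ x ∈ Ioo 0 (Real.pi / 2), 0 < Real.tan (φ x) := fun x hx =>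
    Real.tan_pos_of_pos_of_lt_pi_div_two (hmem x hx).1 (hmem x hx).2
  have hcos : ∀ x ∈ Ico 0 (Real.pi / 2), 0 < Real.cos (φ x) := by
    intro x hx
    rcases hx.1.eq_or_lt with h | h
    · rw [← h, h0]; simp
    · have := hmem x ⟨h, hx.2⟩
      exact Real.cos_pos_of_mem_Ioo ⟨by linarith [this.1], this.2⟩
  have hdneg : ∀ x ∈ Ioo 0 (Real.pi / 2), deriv y x < 0 := fun x hx => by
    rw [(hy x (Ioo_subset_Ico_self hx)).deriv]
    exact mul_neg_of_neg_of_pos (mul_neg_of_neg_of_pos hk (htan x hx)) (hypos x)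
  refine ⟨fun x _ => hypos x, fun x hx => ?_, hdneg, ?_⟩
  · have hanti : StrictAntiOn y (Ico 0 (Real.pi / 2)) := by
      refine strictAntiOn_of_deriv_neg (convex_Ico _ _)
        (fun x hx => (hy x hx).continuousAt.continuousWithinAt) ?_
      rw [interior_Ico]
      exact hdneg
    rw [← hy0]
    exact hanti hmem0 (Ioo_subset_Ico_self hx) hx.1
  -- As `φ' ≤ M`, the choice `r = -k / M` makes `log y - r log cos φ` nonincreasing. Hence `y ≤ (cos
  -- φ) ^ r`, which tends to `0`.
  · set M := (|-k| * (p - 1) + |p - N|) / min 1 (p - 1) + 1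
    have hM : 0 < M := by positivity
    set r := -k / M
    have hr : 0 < r := div_pos (by linarith) hM
    have hd : ∀ x ∈ Ioo 0 (Real.pi / 2),
        HasDerivAt (fun x => Real.log (y x) - r * Real.log (Real.cos (φ x)))
          (k * Real.tan (φ x) + r * Real.tan (φ x) * angleField p N (-k) x (φ x)) x := by
      intro x hx
      have hc := (hcos x (Ioo_subset_Ico_self hx)).ne'
      refine (((hy x (Ioo_subset_Ico_self hx)).log (hypos x).ne').sub
        (((hφ x hx).cos.log hc).const_mul r)).congr_deriv ?_
      rw [mul_div_cancel_right₀ _ (hypos x).ne', Real.tan_eq_sin_div_cos]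
      ring
    have hanti : AntitoneOn (fun x => Real.log (y x) - r * Real.log (Real.cos (φ x)))
        (Ico 0 (Real.pi / 2)) := by
      refine antitoneOn_of_deriv_nonpos (convex_Ico _ _) ?_ ?_ ?_
      · refine ContinuousOn.sub (ContinuousOn.log
          (fun x hx => (hy x hx).continuousAt.continuousWithinAt) fun x _ => (hypos x).ne') ?_
        exact continuousOn_const.mul (ContinuousOn.log
          (Real.continuous_cos.comp_continuousOn hφC.continuousOn) fun x hx => (hcos x hx).ne')
      · rw [interior_Ico]
        exact fun x hx => (hd x hx).differentiableAt.differentiableWithinAt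
      · rw [interior_Ico]
        intro x hx
        rw [(hd x hx).deriv]
        have hF : angleField p N (-k) x (φ x) ≤ M :=
          (angleField_le_of_mem hp hN hx (Ioo_subset_Icc_self (hmem x hx))).trans (by
            simp only [M]; linarith)
        have h1 : r * Real.tan (φ x) * angleField p N (-k) x (φ x) ≤ r * Real.tan (φ x) * M := by
          have := htan x hx
          gcongr
        have h2 : r * Real.tan (φ x) * M = -k * Real.tan (φ x) := by
          simp only [r]
          field_simp
        linarith
    have hle : ∀ x ∈ Ioo 0 (Real.pi / 2), y x ≤ Real.exp (r * Real.log (Real.cos (φ x))) := by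
      intro x hx
      have := hanti hmem0 (Ioo_subset_Ico_self hx) hx.1.le
      simp only [hy0, h0, Real.cos_zero, Real.log_one, mul_zero, sub_zero] at this
      rw [← Real.log_le_iff_le_exp (hypos x)]
      linarith
    have hlim : Tendsto (fun x => Real.exp (r * Real.log (Real.cos (φ x))))
        (𝓝[<] (Real.pi / 2)) (𝓝 0) := by
      refine Real.tendsto_exp_atBot.comp (Tendsto.const_mul_atBot hr
        (Real.tendsto_log_nhdsGT_zero.comp (tendsto_nhdsWithin_iff.2 ⟨?_, ?_⟩)))
      · have := (Real.continuous_cos.tendsto _).comp hend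
        rwa [Real.cos_pi_div_two] at this
      · filter_upwards [Ioo_mem_nhdsLT hpi] with x hx using hcos x (Ioo_subset_Ico_self hx)
    refine squeeze_zero' (Eventually.of_forall fun x => (hypos x).le) ?_ hlim
    filter_upwards [Ioo_mem_nhdsLT hpi] with x hx using hle x hx


/-! ### Uniqueness of the parameter and of the solutions -/

/-- If `κ₂ < κ₁`, then `u` is a strict supersolution for `κ₂` and the gap `u - v` could not close at
`π/2`. -/
lemma param_le_of_angle (hp : 1 < p) (hN : 2 < N) {κ₁ κ₂ : ℝ} {u v : ℝ → ℝ}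
    (hu : ∀ t ∈ Ioo 0 (Real.pi / 2), HasDerivAt u (angleField p N κ₁ t (u t)) t)
    (hv : ∀ t ∈ Ioo 0 (Real.pi / 2), HasDerivAt v (angleField p N κ₂ t (v t)) t)
    (hu0 : Tendsto u (𝓝[>] 0) (𝓝 0)) (hv0 : Tendsto v (𝓝[>] 0) (𝓝 0))
    (hu1 : Tendsto u (𝓝[<] (Real.pi / 2)) (𝓝 (Real.pi / 2)))
    (hv1 : Tendsto v (𝓝[<] (Real.pi / 2)) (𝓝 (Real.pi / 2))) : κ₁ ≤ κ₂ := by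
  by_contra! hlt
  have hp1 : 0 < p - 1 := by linarith
  have hc : 0 < (κ₁ - κ₂) * ((p - 1) / p) :=
    mul_pos (by linarith) (div_pos hp1 (by linarith))
  refine (angle_comparison (κ := κ₂) hp hN hc hu hv hu0 hv0 (fun x hx => ?_)).2
    (by simpa using hu1.sub hv1)
  have hD := angleDen_pos hp (u x)
  have : angleField p N κ₁ x (u x) - angleField p N κ₂ x (u x) =
      (κ₁ - κ₂) * ((p - 1) / angleDen p (u x)) := by
    unfold angleField
    field_simp
    ring
  rw [sub_self, add_zero, this]
  have := angleDen_le hp (u x)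
  have : 0 < κ₁ - κ₂ := by linarith
  gcongr

lemma IsRiccatiProfile.tendsto_arctan (hk : k < 0) {H : ℝ → ℝ} (h : IsRiccatiProfile H) :
    Tendsto (fun x => Real.arctan (H x / k)) (𝓝[<] (Real.pi / 2)) (𝓝 (Real.pi / 2)) :=
  (Real.tendsto_arctan_atTop.mono_right nhdsWithin_le_nhds).comp
    (by simpa only [div_eq_mul_inv] using
      h.tendsto_atBot.atBot_mul_const_of_neg (inv_lt_zero.2 hk))

/-- The field is bounded near `π/2`, so `φ` is Lipschitz there and extends continuously. -/
lemma angle_exists_limit (hp : 1 < p) {κ : ℝ} {φ : ℝ → ℝ}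
    (hφ : ∀ t ∈ Ioo 0 (Real.pi / 2), HasDerivAt φ (angleField p N κ t (φ t)) t) :
    ∃ l, Tendsto φ (𝓝[<] (Real.pi / 2)) (𝓝 l) := by
  have hpi := Real.pi_pos
  have hm := min_one_sub_pos hp
  have hp1 : 0 < p - 1 := by linarith
  have hsub : Ioo (Real.pi / 4) (Real.pi / 2) ⊆ Ioo 0 (Real.pi / 2) :=
    Ioo_subset_Ioo_left (by linarith)
  set M := (|κ| * (p - 1) + |p - N| + |N - 2| * (Real.pi / 4)⁻¹) / min 1 (p - 1)
  have hM : 0 ≤ M := by positivity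
  have hlip : LipschitzOnWith M.toNNReal φ (Ioo (Real.pi / 4) (Real.pi / 2)) := by
    refine (convex_Ioo _ _).lipschitzOnWith_of_nnnorm_hasDerivWithin_le
      (fun x hx => (hφ x (hsub hx)).hasDerivWithinAt) (fun x hx => ?_)
    rw [← NNReal.coe_le_coe, coe_nnnorm, Real.norm_eq_abs, Real.coe_toNNReal _ hM]
    refine (abs_angleField_le hp x _).trans ?_
    have : |Real.cot x| ≤ (Real.pi / 4)⁻¹ := by
      rw [abs_of_nonneg (cot_nonneg_of_mem (hsub hx))]
      exact (cot_le_inv (hsub hx)).trans (inv_anti₀ (by positivity) hx.1.le)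
    simp only [M]
    gcongr
  obtain ⟨g, hg, hgφ⟩ := hlip.extend_real
  refine ⟨g (Real.pi / 2), ((hg.continuous.tendsto _).mono_left nhdsWithin_le_nhds).congr' ?_⟩
  filter_upwards [Ioo_mem_nhdsLT (by linarith : Real.pi / 4 < Real.pi / 2)] with x hx
    using (hgφ hx).symm

/-- If the limit of the angle were below `π/2`, then `y' / y` would be bounded below near `π/2` and
`y` could not tend to `0`. -/
lemma IsSolution.tendsto_arctan (hp : 1 < p) (hk : k < 0) {y : ℝ → ℝ}
    (hy : IsSolution p N k y) (h : IsProfile y) :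
    Tendsto (fun x => Real.arctan (deriv y x / y x / k)) (𝓝[<] (Real.pi / 2))
      (𝓝 (Real.pi / 2)) := by
  have hpi : 0 < Real.pi / 2 := by linarith [Real.pi_pos]
  set φ : ℝ → ℝ := fun x => Real.arctan (deriv y x / y x / k) with hφdef
  have hφ := (hy.angle hp hk.ne le_rfl h.pos).1
  obtain ⟨l, hl⟩ := angle_exists_limit hp hφ
  have hle : l ≤ Real.pi / 2 :=
    le_of_tendsto hl (Eventually.of_forall fun x => (Real.arctan_lt_pi_div_two _).le)
  rcases hle.eq_or_lt with heq | hlt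
  · rwa [heq] at hl
  exfalso
  obtain ⟨B, hlB, hB⟩ := exists_between (max_lt hlt hpi)
  obtain ⟨a, ha, hsub⟩ := mem_nhdsLT_iff_exists_Ioo_subset.1
    ((hl.eventually_lt_const ((le_max_left _ _).trans_lt hlB)).and (Ioo_mem_nhdsLT hpi))
  refine not_tendsto_zero_of_linear_growth (L := -k * Real.tan B) (w' := deriv y) ha
    (fun x hx => hy.hasDerivAt (hsub hx).2) (fun x hx => ?_) (fun x hx => h.pos x (hsub hx).2)
    h.tendsto_zero
  have hφB : φ x < B := (hsub hx).1
  have htan : Real.tan (φ x) < Real.tan B :=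
    Real.strictMonoOn_tan ⟨Real.neg_pi_div_two_lt_arctan _, Real.arctan_lt_pi_div_two _⟩
      ⟨by linarith [(le_max_right l 0).trans_lt hlB], hB⟩ hφB
  have hypos := h.pos x (hsub hx).2
  simp only [hφdef, Real.tan_arctan] at htan
  rw [div_lt_iff_of_neg hk, lt_div_iff₀ hypos] at htan
  linarith

/-- The angles coincide by `angle_unique`, hence so do the logarithmic derivatives; `z / y` is
constant with limit `1` at `0`. -/
lemma IsSolution.eqOn_of_pos (hp : 1 < p) (hN : 2 < N) (hk : k < 0) {y z : ℝ → ℝ}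
    (hy : IsSolution p N k y) (hz : IsSolution p N k z) {b : ℝ} (hb : b ≤ Real.pi / 2)
    (hypos : ∀ x ∈ Ioo 0 b, 0 < y x) (hzpos : ∀ x ∈ Ioo 0 b, 0 < z x) : EqOn z y (Ioo 0 b) := by
  have hpi : 0 < Real.pi / 2 := by linarith [Real.pi_pos]
  obtain ⟨hy1, hy2⟩ := hy.angle hp hk.ne hb hypos
  obtain ⟨hz1, hz2⟩ := hz.angle hp hk.ne hb hzpos
  have hangle := angle_unique hp hN hb hy1 hz1 hy2 hz2
  have hlog : ∀ x ∈ Ioo 0 b, deriv y x * z x = deriv z x * y x := fun x hx => by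
    have h1 := Real.arctan_injective (hangle hx)
    rw [div_left_inj' hk.ne, div_eq_div_iff (hypos x hx).ne' (hzpos x hx).ne'] at h1
    exact h1
  have hsub : Ioo 0 b ⊆ Ioo 0 (Real.pi / 2) := Ioo_subset_Ioo_right hb
  have hd : ∀ x ∈ Ioo 0 b, HasDerivAt (fun x => z x / y x) 0 x := fun x hx => by
    refine ((hz.hasDerivAt (hsub hx)).div (hy.hasDerivAt (hsub hx))
      (hypos x hx).ne').congr_deriv ?_
    rw [mul_comm (z x), hlog x hx, sub_self, zero_div]
  intro x hx
  have hlim : Tendsto (fun x => z x / y x) (𝓝[>] 0) (𝓝 1) := by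
    have h1 := tendsto_nhdsGT_of_continuousOn_Ico hpi hy.continuousOn
    have h2 := tendsto_nhdsGT_of_continuousOn_Ico hpi hz.continuousOn
    rw [hy.init] at h1
    rw [hz.init] at h2
    simpa [Pi.div_def] using h2.div h1 one_ne_zero
  have hconst : Tendsto (fun x => z x / y x) (𝓝[>] 0) (𝓝 (z x / y x)) := by
    refine tendsto_const_nhds.congr' ?_
    filter_upwards [Ioo_mem_nhdsGT (hx.1.trans hx.2)] with t ht
    exact isOpen_Ioo.is_const_of_deriv_eq_zero isPreconnected_Ioo
      (fun s hs => (hd s hs).differentiableAt.differentiableWithinAt)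
      (fun s hs => (hd s hs).deriv) hx ht
  have := tendsto_nhds_unique hconst hlim
  rwa [div_eq_one_iff_eq (hypos x hx).ne'] at this

lemma IsSolution.eqOn (hp : 1 < p) (hN : 2 < N) (hk : k < 0) {y z : ℝ → ℝ}
    (hy : IsSolution p N k y) (hz : IsSolution p N k z)
    (hypos : ∀ x ∈ Ioo 0 (Real.pi / 2), 0 < y x) : EqOn z y (Ico 0 (Real.pi / 2)) := by
  have hzpos : ∀ x ∈ Ioo 0 (Real.pi / 2), 0 < z x := by
    by_contra! hcon
    obtain ⟨x₁, hx₁, hle⟩ := hcon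
    have hsub : Icc 0 x₁ ⊆ Ico 0 (Real.pi / 2) := Icc_subset_Ico_right hx₁.2
    have hS : IsCompact (Icc 0 x₁ ∩ z ⁻¹' Iic 0) :=
      isCompact_Icc.of_isClosed_subset
        ((hz.continuousOn.mono hsub).preimage_isClosed_of_isClosed isClosed_Icc isClosed_Iic)
        inter_subset_left
    -- Up to the first point `c` with `z c ≤ 0` the two solutions agree, so `z c = y c > 0` by
    -- continuity.
    obtain ⟨c, ⟨hc, hzc⟩, hmin⟩ := hS.exists_isLeast ⟨x₁, ⟨hx₁.1.le, le_rfl⟩, hle⟩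
    have hzc : z c ≤ 0 := hzc
    have hc0 : 0 < c := by
      refine hc.1.lt_of_ne fun h => ?_
      rw [← h, hz.init] at hzc
      linarith
    have hcpi : c < Real.pi / 2 := hc.2.trans_lt hx₁.2
    have hpos : ∀ x ∈ Ioo 0 c, 0 < z x := by
      intro x hx
      by_contra! h
      exact hx.2.not_ge (hmin ⟨⟨hx.1.le, hx.2.le.trans hc.2⟩, h⟩)
    have heq := hy.eqOn_of_pos hp hN hk hz hcpi.le
      (fun x hx => hypos x ⟨hx.1, hx.2.trans hcpi⟩) hpos
    have h1 : Tendsto z (𝓝[<] c) (𝓝 (z c)) :=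
      (hz.hasDerivAt ⟨hc0, hcpi⟩).continuousAt.tendsto.mono_left nhdsWithin_le_nhds
    have h2 : Tendsto z (𝓝[<] c) (𝓝 (y c)) := by
      refine ((hy.hasDerivAt ⟨hc0, hcpi⟩).continuousAt.tendsto.mono_left
        nhdsWithin_le_nhds).congr' ?_
      filter_upwards [Ioo_mem_nhdsLT hc0] with x hx using (heq hx).symm
    have := hypos c ⟨hc0, hcpi⟩
    rw [← tendsto_nhds_unique h1 h2] at this
    linarith
  intro x hx
  rcases hx.1.eq_or_lt with h | h
  · rw [← h, hy.init, hz.init]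
  · exact hy.eqOn_of_pos hp hN hk hz le_rfl hypos hzpos ⟨h, hx.2⟩

lemma IsRiccatiSolution.eqOn (hp : 1 < p) (hN : 2 < N) (hk : k < 0) {G H : ℝ → ℝ}
    (hH : IsRiccatiSolution p N k H) (hG : IsRiccatiSolution p N k G) :
    EqOn G H (Ico 0 (Real.pi / 2)) := by
  obtain ⟨hH1, hH2⟩ := hH.angle hp hk.ne
  obtain ⟨hG1, hG2⟩ := hG.angle hp hk.ne
  intro x hx
  rcases hx.1.eq_or_lt with h | h
  · rw [← h, hH.init, hG.init]
  · have h1 := Real.arctan_injective (angle_unique hp hN le_rfl hG1 hH1 hG2 hH2 ⟨h, hx.2⟩)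
    rwa [div_left_inj' hk.ne] at h1

/-- Uniqueness holds among all negative parameters, so a single `k` serves both choices of the
interval. -/
theorem exists_hasUniqueExponent (hp : 1 < p) (hN : 2 < N) :
    ∃ k, k < 0 ∧ N - p < -k * (p - 1) ∧
      ∀ I ⊆ Iio 0, k ∈ I → HasUniqueExponent p N I := by
  have hpi : 0 < Real.pi / 2 := by linarith [Real.pi_pos]
  obtain ⟨κ, φ, hκ, hκ', hφ, hmem, hpos, h0, hφC, hend⟩ := exists_angle_profile hp hN
  obtain ⟨k, rfl⟩ : ∃ k, κ = -k := ⟨-κ, by ring⟩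
  have hk : k < 0 := by linarith
  refine ⟨k, hk, hκ', fun I hI hkI => ?_⟩
  have hφ0 : Tendsto φ (𝓝[>] 0) (𝓝 0) := by
    have := tendsto_nhdsGT_of_continuousOn_Ico hpi hφC.continuousOn
    rwa [h0] at this
  have hH := isRiccatiSolution_tan hp hk.ne hφ hmem h0 hφC
  have hHP := isRiccatiProfile_tan hp hk hφ hmem hpos hend
  obtain ⟨y, hy0, hypos, hyd⟩ := exists_pos_of_logDeriv hpi hH.contDiffOn.continuousOn
  have hy := isSolution_of_logDeriv hH hy0 hyd
  have hyP := isProfile_of_logDeriv hp hN hk hφ hmem h0 hφC hend hy0 hypos hyd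
  refine ⟨k, hkI, ⟨y, hy, hyP, fun z hz => hy.eqOn hp hN hk hz hyP.pos⟩,
    ⟨_, hH, hHP, fun G hG => hH.eqOn hp hN hk hG⟩, fun z G hz hG x hx => ?_,
    fun k' hk' ⟨z, hz, hzP⟩ => ?_, fun k' hk' ⟨G, hG, hGP⟩ => ?_⟩
  · have hzy := hy.eqOn hp hN hk hz hyP.pos
    have hev : z =ᶠ[𝓝 x] y := by
      filter_upwards [Ioo_mem_nhds hx.1 hx.2] with t ht using hzy (Ioo_subset_Ico_self ht)
    rw [hev.deriv_eq, hev.eq_of_nhds, (hyd x (Ioo_subset_Ico_self hx)).deriv,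
      mul_div_cancel_right₀ _ (hypos x).ne']
    exact hH.eqOn hp hN hk hG (Ioo_subset_Ico_self hx)
  · have hk'0 : k' < 0 := hI hk'
    obtain ⟨h1, h2⟩ := hz.angle hp hk'0.ne le_rfl hzP.pos
    have h3 := hz.tendsto_arctan hp hk'0 hzP
    have := param_le_of_angle hp hN h1 hφ h2 hφ0 h3 hend
    have := param_le_of_angle hp hN hφ h1 hφ0 h2 hend h3
    linarith
  · have hk'0 : k' < 0 := hI hk'
    obtain ⟨h1, h2⟩ := hG.angle hp hk'0.ne
    have h3 := hGP.tendsto_arctan hk'0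
    have := param_le_of_angle hp hN h1 hφ h2 hφ0 h3 hend
    have := param_le_of_angle hp hN hφ h1 hφ0 h2 hend h3
    linarith

end Quasiradial

theorem theorem4p1 (p N : ℝ) (hN : 2 < N) (hp : 1 < p) :
    (p < N → Quasiradial.HasUniqueExponent p N (Set.Iio ((N - p) / (1 - p)))) ∧
    (N ≤ p → Quasiradial.HasUniqueExponent p N (Set.Iio 0)) := by
  obtain ⟨k, hk, hkp, h⟩ := Quasiradial.exists_hasUniqueExponent hp hN
  refine ⟨fun hpN => h _ (Iio_subset_Iio ?_) ?_, fun _ => h _ Subset.rfl hk⟩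
  · exact div_nonpos_of_nonneg_of_nonpos (by linarith) (by linarith)
  · rw [mem_Iio, lt_div_iff_of_neg (by linarith)]
    linarith
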